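/- Let $N\geq 1$ be an integer and let $\kappa\in\frac12\mathbb{Z}$ with $\kappa>2$; assume that either $\kappa$ is an even integer, or $\kappa\notin\mathbb{Z}$ and $4\mid N$. All powers are principal branches. For $f:\mathbb{H}\to\mathbb{C}$ and $M=\left(\begin{smallmatrix}a&b\\c&d\end{smallmatrix}\right)\in\Gamma_0(N)$ let $f|_\kappa M(z)=(cz+d)^{-\kappa}f(Mz)$ if $\kappa\in\mathbb{Z}$ and $f|_\kappa M(z)=\left(\frac cd\right)^{-2\kappa}\varepsilon_d^{2\kappa}(cz+d)^{-\kappa}f(Mz)$ if $\kappa\notin\mathbb{Z}$, where $\left(\frac{\cdot}{\cdot}\right)$ is the Kronecker symbol, and $\varepsilon_d=1$ for $d\equiv1\pmod 4$, $\varepsilon_d=i$ for $d\equiv3\pmod 4$. Let $\Gamma_\infty=\{\pm\left(\begin{smallmatrix}1&n\\0&1\end{smallmatrix}\right):n\in\mathbb{Z}\}$. For $z,\mathfrak{z}\in\mathbb{H}$, $\mathfrak{z}_2=\operatorname{Im}\mathfrak{z}$, $n\in\mathbb{N}$ and any $-2\mathfrak{z}_2<\alpha<0$ put $$\mathcal{P}_{\kappa,n,N}(z)=\sum_{M\in\Gamma_\infty\backslash\Gamma_0(N)}e^{2\pi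 inz}\big|_\kappa M,\qquad \mathcal{I}_{\kappa,-n}(\mathfrak{z}_2)=\int_{i\alpha-\infty}^{i\alpha+\infty}\frac{e^{-2\pi int}}{(t+2i\mathfrak{z}_2)^{\kappa-1}}\frac{dt}{t},$$ $$K_{\kappa,N}(z,\mathfrak{z})=\frac{i}{\pi}(2i\mathfrak{z}_2)^{\kappa-1}\sum_{n\geq1}\mathcal{I}_{\kappa,-n}(\mathfrak{z}_2)\,e^{-2\pi in\mathfrak{z}}\,\mathcal{P}_{\kappa,n,N}(z),\qquad \Psi_{\kappa,0,N}(w,z)=\sum_{M\in\Gamma_0(N)}(w-\overline z)^{-\kappa}\big|_{\kappa,w}M.$$ For a function $g$ of weight $\kappa$ on $\mathbb{H}$ let its non-holomorphic Eichler integral be $$g^*(\mathfrak{z})=(2i)^{1-\kappa}\int_{-\overline{\mathfrak{z}}}^{i\infty}g^{c}(w)(w+\mathfrak{z})^{\kappa-2}\,dw,\qquad g^c(w)=\overline{g(-\overline w)},$$ the integral being taken along the vertical ray from $-\overline{\mathfrak z}$, and let $\Psi^*_{\kappa,0,N}(\mathfrak{z},z)$ be the value at $\mathfrak{z}$ of $g^*$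 for $g(w)=\Psi_{\kappa,0,N}(w,z)$. Then all these series converge absolutely, all these integrals converge absolutely, and for all $z,\mathfrak{z}\in\mathbb{H}$ $$K_{\kappa,N}(z,\mathfrak{z})=-\frac{2^{\kappa-2}(\kappa-1)}{i^{\kappa}\pi}\,\Psi^*_{\kappa,0,N}(\mathfrak{z},z).$$ (For even integral $\kappa$ the constant equals $-i^\kappa(\kappa-1)2^{\kappa-2}/\pi$.) -/

import Mathlib

open UpperHalfPlane MeasureTheory Set
open scoped MatrixGroups Real

noncomputable section

namespace Petersson

/-! Half-integral weights `κ ∈ ½ℤ` are encoded by the integer `k = 2κ`.  All complex powers with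
exponent `κ`, `κ - 1`, … are principal branches. -/

/-- The weight `κ = k / 2`, as a complex number. -/
def wt (k : ℤ) : ℂ := (k : ℂ) / 2

/-- The Kronecker symbol `(a / n)`: multiplicative in `n`, equal to the Legendre symbol at odd
primes, with `(a / 2) = 0, 1, -1` for `a` even, `a ≡ ±1`, `a ≡ ±3 (mod 8)`, with
`(a / -1) = -1` for `a < 0` and `1` for `a ≥ 0`, and with `(a / 0) = 1` for `a = ±1` and `0`
otherwise. -/
def kronecker (a n : ℤ) : ℤ :=
  if n = 0 then (if a.natAbs = 1 then 1 else 0)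
  else (if a < 0 ∧ n < 0 then -1 else 1) * (ZMod.χ₈ (a : ZMod 8)) ^ (padicValNat 2 n.natAbs) *
    jacobiSym a (n.natAbs / 2 ^ padicValNat 2 n.natAbs)

/-- `ε_d` for odd `d`. -/
def eps (d : ℤ) : ℂ := if d % 4 = 1 then 1 else Complex.I

/-- The weight `κ = k / 2` slash action: the plain one for `κ ∈ ℤ`, the one with the theta
multiplier for `κ ∈ ½ℤ ∖ ℤ`. -/
def slash (k : ℤ) (f : ℍ → ℂ) (M : SL(2, ℤ)) (z : ℍ) : ℂ :=
  if Even k then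
    ((M 1 0 : ℂ) * z + (M 1 1 : ℂ)) ^ (-wt k) * f (M • z)
  else
    (kronecker (M 1 0) (M 1 1) : ℂ) ^ (-k) * eps (M 1 1) ^ k *
      ((M 1 0 : ℂ) * z + (M 1 1 : ℂ)) ^ (-wt k) * f (M • z)

/-- `Γ_∞ = {± (1 n; 0 1) : n ∈ ℤ}`. -/
def GammaInf : Subgroup SL(2, ℤ) where
  carrier := {M | ∃ n : ℤ, M = ModularGroup.T ^ n ∨ M = -ModularGroup.T ^ n}
  one_mem' := ⟨0, by simp⟩
  mul_mem' := by
    rintro a b ⟨n, rfl | rfl⟩ ⟨m, rfl | rfl⟩ <;> refine ⟨n + m, ?_⟩ <;> simp [zpow_add]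
  inv_mem' := by
    rintro a ⟨n, rfl | rfl⟩
    · exact ⟨-n, Or.inl (zpow_neg _ _).symm⟩
    · exact ⟨-n, Or.inr (inv_eq_of_mul_eq_one_right (by simp))⟩

/-- The set of cosets `Γ_∞ \ Γ₀(N)`. -/
abbrev CuspCosets (N : ℕ) : Type :=
  Quotient (QuotientGroup.rightRel (GammaInf.subgroupOf (CongruenceSubgroup.Gamma0 N)))

/-- A representative in `Γ₀(N)` of a coset. -/
def CuspCosets.rep {N : ℕ} (q : CuspCosets N) : SL(2, ℤ) :=
  ((Quotient.out q : CongruenceSubgroup.Gamma0 N) : SL(2, ℤ))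

/-- The summand of the Poincaré series `𝒫_{κ,m,N}(z) = ∑_{M ∈ Γ_∞ \ Γ₀(N)} e^{2πimz}|_κ M`. The summand
does not depend on the representative when `κ` is an even integer, or when `κ ∈ ½ℤ ∖ ℤ` and
`4 ∣ N`. -/
def poincareTerm (k m : ℤ) {N : ℕ} (z : ℍ) (q : CuspCosets N) : ℂ :=
  slash k (fun w : ℍ => Complex.exp (2 * π * Complex.I * m * w)) q.rep z

/-- The classical Poincaré series `𝒫_{κ,m,N}(z)`, the sum of `poincareTerm`. -/
def poincare (k m : ℤ) (N : ℕ) (z : ℍ) : ℂ :=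
  ∑' q : CuspCosets N, poincareTerm k m z q

/-- The summand of the elliptic Poincaré series
`Ψ_{κ,n,N}(z, 𝔷) = ∑_{M ∈ Γ₀(N)} ((z - 𝔷)^n / (z - conj 𝔷)^(κ + n))|_{κ,z} M`. -/
def ellipticTerm (k n : ℤ) {N : ℕ} (z τ : ℍ) (M : CongruenceSubgroup.Gamma0 N) : ℂ :=
  slash k
    (fun w : ℍ => ((w : ℂ) - τ) ^ n / ((w : ℂ) - (starRingEnd ℂ) (τ : ℂ)) ^ (wt k + n)) M z

/-- The elliptic Poincaré series `Ψ_{κ,n,N}(z, 𝔷)`, the sum of `ellipticTerm`. -/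
def elliptic (k n : ℤ) (N : ℕ) (z τ : ℍ) : ℂ :=
  ∑' M : CongruenceSubgroup.Gamma0 N, ellipticTerm k n z τ M

/-- The integrand of `𝓘_{κ,r}(y)` at the point `t = x + iα` of the line `Im t = α`. -/
def lineIntegrand (k r : ℤ) (y α x : ℝ) : ℂ :=
  Complex.exp (2 * π * Complex.I * r * (x + α * Complex.I)) /
    ((x + α * Complex.I) + 2 * Complex.I * y) ^ (wt k - 1) / (x + α * Complex.I)

/-- `𝓘_{κ,r}(y) = ∫_{iα - ∞}^{iα + ∞} e^{2πirt} (t + 2iy)^{1 - κ} dt / t`. -/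
def lineIntegral (k r : ℤ) (y α : ℝ) : ℂ := ∫ x : ℝ, lineIntegrand k r y α x

/-- The `n`-th summand of Petersson's function `K_{κ,N}(z, τ)`. -/
def KTerm (k : ℤ) (N : ℕ) (α : ℝ) (z τ : ℍ) (n : ℕ+) : ℂ :=
  lineIntegral k (-(n : ℤ)) τ.im α * Complex.exp (-2 * π * Complex.I * (n : ℂ) * τ) *
    poincare k n N z

/-- Petersson's function `K_{κ,N}(z, τ)`, the integrals `𝓘_{κ,-n}` being taken along the line
`Im t = α`, where `-2 Im τ < α < 0`. -/
def K (k : ℤ) (N : ℕ) (α : ℝ) (z τ : ℍ) : ℂ :=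
  Complex.I / π * (2 * Complex.I * τ.im) ^ (wt k - 1) * ∑' n : ℕ+, KTerm k N α z τ n

/-- The point `-conj z` of the upper half-plane. -/
def negConj (z : ℍ) : ℍ := ⟨-(starRingEnd ℂ) (z : ℂ), by simpa using z.im_pos⟩

/-- `g^c(w) = conj (g (-conj w))`. -/
def conjFun (g : ℍ → ℂ) (w : ℍ) : ℂ := (starRingEnd ℂ) (g (negConj w))

/-- The integrand of the non-holomorphic Eichler integral of `g`, of weight `κ = k / 2`, pulled back
to `t > 0` by the parametrization `w = -conj z + it` of the vertical ray from `-conj z` to `i∞`;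
the factor `i` comes from `dw = i dt`. -/
def eichlerIntegrand (k : ℤ) (g : ℍ → ℂ) (z : ℍ) (t : ℝ) : ℂ :=
  conjFun g (ofComplex ((negConj z : ℂ) + t * Complex.I)) *
    ((negConj z : ℂ) + t * Complex.I + z) ^ (wt k - 2) * Complex.I

/-- The non-holomorphic Eichler integral, of weight `2 - κ`, of a function `g` of weight `κ`:
`g*(z) = (2i)^{1 - κ} ∫_{-conj z}^{i∞} g^c(w) (w + z)^{κ - 2} dw`. -/
def eichler (k : ℤ) (g : ℍ → ℂ) (z : ℍ) : ℂ :=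
  (2 * Complex.I) ^ (1 - wt k) * ∫ t in Ioi (0 : ℝ), eichlerIntegrand k g z t

end Petersson

end

/-!
Both sides of the identity are the same series over `n ≥ 1`, namely a constant times
`∑ Γ(κ - 1, 4πny) e^{-2πinτ} 𝒫_{κ,n,N}(z)` with `y = Im τ` and the incomplete Gamma function
written as `∫_n^∞ s^{κ-2} e^{-4πys} ds`.

For `K`, the function `(t + 2iy)^{1-κ} / t` on the line `Im t = α` is the Fourier transform of the
convolution of `s^{κ-2} e^{-(4πy + 2πα)s}` (on `s > 0`) with `e^{-2παv}` (on `v < 0`), so Fourier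
inversion evaluates `𝓘_{κ,-n}(y)`: this is `integral_exp_mul_lineKernel`.

For the Eichler integral one needs the Fourier expansion of `w ↦ Ψ_{κ,0,N}(w, z)`. Write `J(M, w)` for
the factor in `f|_κ M(w) = J(M, w) f(Mw)` (`autFactor`). The kernel has the symmetry
`J(M, w) (Mw - conj z)^{-κ} = conj (J(M⁻¹, z)) (w - conj (M⁻¹z))^{-κ}` (`autFactor_symm`). In
half-integral weight it compares the theta multiplier at `M` with the one at `M⁻¹` only, and that case
of the cocycle relation follows from the periodicity of the Jacobi symbol in its lower argument
(`kronecker_inv`) together with a comparison of arguments of principal powers.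
After the symmetry, the sum over `Γ₀(N)` is a sum over `Γ_∞ \ Γ₀(N)` of sums over translates of `w`,
which the Lipschitz formula (`lipschitz_summation`) turns into exponentials. The coefficient of
`e^{2πinw}` is then `n^{κ-1}` times the complex conjugate of `𝒫_{κ,n,N}(z)`
(`elliptic_eq_tsum_poincare`). All Poincaré series are bounded by `∑ |cz + d|^{-κ}`, uniformly in `n`,
so the expansion can be integrated term by term (`integrable_and_hasSum_eichler`), and only the
constants remain to be compared (`constant_identity`).
-/

noncomputable section

namespace Petersson

/-! ### The Kronecker symbol and the numbers `ε_d` -/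

lemma kronecker_of_odd (a : ℤ) {n : ℤ} (hn : Odd n) :
    kronecker a n = (if a < 0 ∧ n < 0 then -1 else 1) * jacobiSym a n.natAbs := by
  have h0 : n ≠ 0 := by rintro rfl; simp at hn
  have h2 : padicValNat 2 n.natAbs = 0 := by
    apply padicValNat.eq_zero_of_not_dvd
    rw [← even_iff_two_dvd, Int.natAbs_even]
    exact Int.not_even_iff_odd.mpr hn
  simp [kronecker, h0, h2]

lemma kronecker_trichotomy (a : ℤ) {n : ℤ} (hn : Odd n) :
    kronecker a n = 0 ∨ kronecker a n = 1 ∨ kronecker a n = -1 := by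
  rw [kronecker_of_odd a hn]
  rcases jacobiSym.trichotomy a n.natAbs with h | h | h <;> rw [h] <;> split_ifs <;> simp

lemma eps_ne_zero (d : ℤ) : eps d ≠ 0 := by
  unfold eps; split_ifs <;> simp

lemma norm_eps (d : ℤ) : ‖eps d‖ = 1 := by
  unfold eps; split_ifs <;> simp

/-- The nontrivial character modulo `4` at an odd integer `d`. -/
def chi (d : ℤ) : ℤ := if d % 4 = 1 then 1 else -1

lemma chi_mul_self (d : ℤ) : chi d * chi d = 1 := by
  unfold chi; split_ifs <;> simp

lemma eps_mul_self (d : ℤ) : eps d * eps d = chi d := by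
  unfold eps chi; split_ifs <;> simp

lemma chi_neg {d : ℤ} (hd : Odd d) : chi (-d) = -chi d := by
  unfold chi; rw [Int.odd_iff] at hd; split_ifs <;> omega

lemma jacobiSym_neg_natAbs (c : ℤ) {d : ℤ} (hd : Odd d) :
    jacobiSym (-c) d.natAbs = (if d < 0 then -1 else 1) * chi d * jacobiSym c d.natAbs := by
  have hd' : Odd d.natAbs := Int.natAbs_odd.mpr hd
  rw [jacobiSym.neg _ hd']
  congr 1
  have h1 := ZMod.χ₄_nat_eq_if_mod_four d.natAbs
  rw [h1]
  unfold chi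
  rw [Int.odd_iff] at hd
  split_ifs <;> omega

lemma kronecker_neg_neg_of_pos {c d : ℤ} (hc : 0 < c) (hd : Odd d) :
    kronecker (-c) (-d) = -chi d * kronecker c d := by
  rw [kronecker_of_odd _ hd, kronecker_of_odd _ hd.neg, Int.natAbs_neg, jacobiSym_neg_natAbs c hd]
  have h0 : d ≠ 0 := by rintro rfl; simp at hd
  have : ¬ c < 0 := by omega
  rcases lt_or_gt_of_ne h0 with h | h
  · have h' : ¬ (0 < d) := by omega
    simp [h, h', hc, this]
  · have h' : ¬ (d < 0) := by omega
    simp [h, h', hc, this]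

lemma kronecker_neg_neg_of_neg {c d : ℤ} (hc : c < 0) (hd : Odd d) :
    kronecker (-c) (-d) = chi d * kronecker c d := by
  have h := kronecker_neg_neg_of_pos (c := -c) (d := -d) (by omega) hd.neg
  rw [neg_neg, neg_neg, chi_neg hd, neg_neg] at h
  rw [h, ← mul_assoc, chi_mul_self, one_mul]

/-- For `4 ∣ c` the symbol `(c / ·)` is periodic modulo `c`, and takes the value `1` at `±1`. This is
quadratic reciprocity, in the form `jacobiSym.mod_right`. -/
lemma jacobiSym_eq_one_of_modEq {c : ℤ} (hc : 0 < c) (h4 : 4 ∣ c) {n : ℕ} (hn : Odd n)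
    (h : c ∣ n - 1 ∨ c ∣ n + 1) : jacobiSym c n = 1 := by
  obtain ⟨e, rfl⟩ := h4
  have he : 0 < e := by omega
  lift e to ℕ using he.le
  have key : ∀ m : ℕ, Odd m → jacobiSym (4 * (e : ℤ)) m = jacobiSym e m := fun m hm ↦ by
    rw [← jacobiSym.div_four_left (a := 4 * (e : ℤ)) (by simp) (Nat.odd_iff.mp hm)]
    simp
  rw [key n hn, jacobiSym.mod_right _ hn, Int.natAbs_natCast]
  rcases h with h | h
  · have h1 : n % (4 * e) = 1 := by
      obtain ⟨x, hx⟩ := h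
      have : ((n : ℤ) % (4 * e)) = 1 := by
        rw [show (n : ℤ) = 1 + 4 * e * x by omega, Int.add_mul_emod_self_left]
        exact Int.emod_eq_of_lt (by omega) (by omega)
      exact_mod_cast this
    rw [h1, jacobiSym.one_right]
  · have h1 : n % (4 * e) = 4 * e - 1 := by
      obtain ⟨x, hx⟩ := h
      have : ((n : ℤ) % (4 * e)) = 4 * e - 1 := by
        rw [show (n : ℤ) = (4 * e - 1) + 4 * e * (x - 1) by linarith [mul_sub (4 * (e : ℤ)) x 1],
          Int.add_mul_emod_self_left]
        exact Int.emod_eq_of_lt (by omega) (by omega)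
      have h' : ((n % (4 * e) : ℕ) : ℤ) = 4 * e - 1 := by push_cast; exact this
      omega
    have hodd : Odd (4 * e - 1) := by rw [Nat.odd_iff]; omega
    rw [h1, ← key _ hodd, jacobiSym.mod_left]
    have h2 : (4 * (e : ℤ)) % ((4 * e - 1 : ℕ) : ℤ) = 1 := by
      rw [show (4 * (e : ℤ)) = 1 + ((4 * e - 1 : ℕ) : ℤ) * 1 by omega, Int.add_mul_emod_self_left]
      exact Int.emod_eq_of_lt (by omega) (by omega)
    rw [h2, jacobiSym.one_left]

lemma chi_eq_of_det {a b c d : ℤ} (h4 : 4 ∣ c) (hdet : a * d - b * c = 1) : chi a = chi d := by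
  obtain ⟨e, rfl⟩ := h4
  have h : (a * d) % 4 = 1 := by
    have : a * d = 1 + 4 * (b * e) := by linarith
    rw [this]; omega
  have ha : a % 4 = 0 ∨ a % 4 = 1 ∨ a % 4 = 2 ∨ a % 4 = 3 := by omega
  have hd : d % 4 = 0 ∨ d % 4 = 1 ∨ d % 4 = 2 ∨ d % 4 = 3 := by omega
  rw [Int.mul_emod] at h
  unfold chi
  rcases ha with ha | ha | ha | ha <;> rcases hd with hd | hd | hd | hd <;>
    rw [ha, hd] at h <;> simp [ha, hd] at h ⊢

lemma eps_eq_of_chi {a d : ℤ} (h : chi a = chi d) : eps a = eps d := by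
  unfold chi at h; unfold eps
  split_ifs at h ⊢ <;> rfl

lemma odd_of_det {a b c d : ℤ} (h4 : 4 ∣ c) (hdet : a * d - b * c = 1) : Odd a ∧ Odd d := by
  obtain ⟨e, rfl⟩ := h4
  have : Odd (a * d) := ⟨2 * (b * e), by linarith⟩
  exact Int.odd_mul.mp this

lemma kronecker_inv_of_pos {a b c d : ℤ} (hc : 0 < c) (h4 : 4 ∣ c) (hdet : a * d - b * c = 1) :
    kronecker c d = kronecker (-c) a * chi d := by
  obtain ⟨ha, hd⟩ := odd_of_det h4 hdet
  have ha0 : a ≠ 0 := by rintro rfl; simp at ha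
  have hd0 : d ≠ 0 := by rintro rfl; simp at hd
  have hJ : jacobiSym c a.natAbs * jacobiSym c d.natAbs = 1 := by
    rw [← jacobiSym.mul_right' _ (by simpa using ha0) (by simpa using hd0), ← Int.natAbs_mul]
    apply jacobiSym_eq_one_of_modEq hc h4
    · exact Int.natAbs_odd.mpr (ha.mul hd)
    · rcases le_total 0 (a * d) with h | h
      · left; rw [Int.natCast_natAbs, abs_of_nonneg h]
        exact ⟨b, by linarith⟩
      · right; rw [Int.natCast_natAbs, abs_of_nonpos h]
        exact ⟨-b, by linarith⟩
  have h1 : kronecker c d = jacobiSym c d.natAbs := by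
    rw [kronecker_of_odd _ hd, if_neg (by omega), one_mul]
  have h2 : kronecker (-c) a = chi a * jacobiSym c a.natAbs := by
    rw [kronecker_of_odd _ ha, jacobiSym_neg_natAbs _ ha]
    by_cases h : a < 0
    · simp [h, hc]
    · simp [h]
  have h3 : jacobiSym c a.natAbs = jacobiSym c d.natAbs := by
    rcases Int.mul_eq_one_iff_eq_one_or_neg_one.mp hJ with h | h <;> rw [h.1, h.2]
  rw [h1, h2, chi_eq_of_det h4 hdet, mul_right_comm, chi_mul_self, one_mul, h3]

/-- The case of the cocycle relation of the theta multiplier that relates a matrix in `Γ₀(4)` to its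
inverse. -/
lemma kronecker_inv {a b c d : ℤ} (hc : c ≠ 0) (h4 : 4 ∣ c) (hdet : a * d - b * c = 1) :
    kronecker c d = kronecker (-c) a * chi d := by
  rcases lt_or_gt_of_ne hc with h | h
  · have := kronecker_inv_of_pos (a := d) (b := -b) (c := -c) (d := a) (by omega) (by simpa using h4)
      (by linarith)
    rw [neg_neg] at this
    rw [this, chi_eq_of_det h4 hdet, mul_assoc, chi_mul_self, mul_one]
  · exact kronecker_inv_of_pos h h4 hdet

/-! ### Principal powers on half-planes -/

/-- If `ab = cd`, then `a^s b^s = c^s d^s` for principal powers as soon as the sums of the arguments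
on the two sides differ by less than `2π`. -/
lemma cpow_mul_cpow_eq {a b c d : ℂ} (ha : a ≠ 0) (hb : b ≠ 0) (hc : c ≠ 0) (hd : d ≠ 0)
    (h : a * b = c * d) (h1 : a.arg + b.arg - (c.arg + d.arg) < 2 * π)
    (h2 : -(2 * π) < a.arg + b.arg - (c.arg + d.arg)) (s : ℂ) :
    a ^ s * b ^ s = c ^ s * d ^ s := by
  have hl : Complex.log a + Complex.log b = Complex.log c + Complex.log d := by
    have he : Complex.exp (Complex.log a + Complex.log b) =
        Complex.exp (Complex.log c + Complex.log d) := by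
      rw [Complex.exp_add, Complex.exp_add, Complex.exp_log ha, Complex.exp_log hb,
        Complex.exp_log hc, Complex.exp_log hd, h]
    obtain ⟨n, hn⟩ := Complex.exp_eq_exp_iff_exists_int.mp he
    have him := congrArg Complex.im hn
    simp only [Complex.add_im, Complex.log_im, Complex.mul_im, Complex.intCast_re,
      Complex.intCast_im, Complex.mul_re, Complex.ofReal_re, Complex.ofReal_im, Complex.I_re,
      Complex.I_im, Complex.re_ofNat, Complex.im_ofNat] at him
    have hn0 : n = 0 := by
      have hp := Real.pi_pos
      have e : a.arg + b.arg - (c.arg + d.arg) = n * (2 * π) := by linarith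
      rw [e] at h1 h2
      have u1 : (n : ℝ) < 1 := by nlinarith
      have u2 : (-1 : ℝ) < n := by nlinarith
      have v1 : n < 1 := by exact_mod_cast u1
      have v2 : -1 < n := by exact_mod_cast u2
      omega
    rw [hn, hn0]; simp
  rw [Complex.cpow_def_of_ne_zero ha, Complex.cpow_def_of_ne_zero hb,
    Complex.cpow_def_of_ne_zero hc, Complex.cpow_def_of_ne_zero hd, ← Complex.exp_add,
    ← Complex.exp_add, ← add_mul, ← add_mul, hl]

lemma ne_zero_of_im_ne_zero {z : ℂ} (h : z.im ≠ 0) : z ≠ 0 := by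
  rintro rfl; simp at h

lemma arg_mem_of_im_pos {z : ℂ} (h : 0 < z.im) : 0 < z.arg ∧ z.arg < π := by
  refine ⟨lt_of_le_of_ne (Complex.arg_nonneg_iff.mpr h.le) ?_,
    lt_of_le_of_ne (Complex.arg_le_pi z) ?_⟩
  · intro h0; exact h.ne' (Complex.arg_eq_zero_iff.mp h0.symm).2
  · intro h0; exact h.ne' (Complex.arg_eq_pi_iff.mp h0).2

lemma arg_mem_of_im_neg {z : ℂ} (h : z.im < 0) : -π < z.arg ∧ z.arg < 0 :=
  ⟨Complex.neg_pi_lt_arg z, Complex.arg_neg_iff.mpr h⟩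

lemma log_neg_of_im_pos {z : ℂ} (h : 0 < z.im) : Complex.log (-z) = Complex.log z - π * Complex.I := by
  apply Complex.ext
  · simp [Complex.log_re]
  · simp [Complex.log_im, Complex.arg_neg_eq_arg_sub_pi_of_im_pos h]

/-- On the upper half-plane the square root of `-z` is `-i √z`. -/
lemma neg_cpow_half_of_im_pos {z : ℂ} (h : 0 < z.im) :
    (-z) ^ (1 / 2 : ℂ) = -Complex.I * z ^ (1 / 2 : ℂ) := by
  have hz := ne_zero_of_im_ne_zero h.ne'
  rw [Complex.cpow_def_of_ne_zero (neg_ne_zero.mpr hz), Complex.cpow_def_of_ne_zero hz,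
    log_neg_of_im_pos h, sub_mul, Complex.exp_sub, div_eq_mul_inv, ← Complex.exp_neg,
    show -(π * Complex.I * (1 / 2)) = -(π : ℂ) / 2 * Complex.I by ring, Complex.exp_neg_pi_div_two_mul_I]
  ring

lemma neg_one_cpow_half : (-1 : ℂ) ^ (2 : ℂ)⁻¹ = Complex.I := by
  rw [Complex.cpow_def_of_ne_zero (by simp), Complex.log_neg_one,
    show π * Complex.I * (2 : ℂ)⁻¹ = π / 2 * Complex.I by ring, Complex.exp_pi_div_two_mul_I]

lemma cpow_conj_of_im_ne_zero {z : ℂ} (h : z.im ≠ 0) {s : ℂ} (hs : (starRingEnd ℂ) s = s) :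
    (starRingEnd ℂ) (z ^ s) = ((starRingEnd ℂ) z) ^ s := by
  have : z.arg ≠ π := fun h0 ↦ h (Complex.arg_eq_pi_iff.mp h0).2
  rw [Complex.conj_cpow _ _ this, hs]

/-! ### Automorphy factors -/

/-- The automorphy factor of the weight `k / 2` slash action. -/
def autFactor (k : ℤ) (M : SL(2, ℤ)) (z : ℍ) : ℂ :=
  if Even k then ((M 1 0 : ℂ) * z + (M 1 1 : ℂ)) ^ (-wt k)
  else (kronecker (M 1 0) (M 1 1) : ℂ) ^ (-k) * eps (M 1 1) ^ k *
      ((M 1 0 : ℂ) * z + (M 1 1 : ℂ)) ^ (-wt k)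

lemma slash_eq (k : ℤ) (f : ℍ → ℂ) (M : SL(2, ℤ)) (z : ℍ) :
    slash k f M z = autFactor k M z * f (M • z) := by
  unfold slash autFactor; split_ifs <;> rfl

/-- The automorphy factor `(c/d) ε_d⁻¹ (cz + d)^{1/2}` of the theta function. -/
def thetaFactor (M : SL(2, ℤ)) (z : ℍ) : ℂ :=
  kronecker (M 1 0) (M 1 1) * (eps (M 1 1))⁻¹ * ((M 1 0 : ℂ) * z + (M 1 1 : ℂ)) ^ (1 / 2 : ℂ)

lemma cpow_half_zpow (x : ℂ) (k : ℤ) : (x ^ (1 / 2 : ℂ)) ^ (-k) = x ^ (-wt k) := by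
  rw [← Complex.cpow_mul_int]
  congr 1; simp [wt]; ring

lemma autFactor_of_odd {k : ℤ} (hk : Odd k) (M : SL(2, ℤ)) (z : ℍ) :
    autFactor k M z = thetaFactor M z ^ (-k) := by
  rw [autFactor, if_neg (Int.not_even_iff_odd.mpr hk), thetaFactor, mul_zpow, mul_zpow,
    cpow_half_zpow, inv_zpow, zpow_neg (eps _), inv_inv]

lemma wt_neg_eq_neg_mul_two {k l : ℤ} (hk : k = 4 * l) : -wt k = ((-2 * l : ℤ) : ℂ) := by
  rw [wt, hk]; push_cast; ring

lemma thetaFactor_neg {M : SL(2, ℤ)} (hd : Odd (M 1 1)) (z : ℍ) :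
    thetaFactor (-M) z = thetaFactor M z := by
  unfold thetaFactor
  simp only [Matrix.SpecialLinearGroup.coe_neg, Matrix.neg_apply, Int.cast_neg]
  set c := M 1 0 with hc
  set d := M 1 1
  have hE : (chi d : ℂ) * (eps (-d))⁻¹ = -Complex.I * (eps d)⁻¹ := by
    rw [Int.odd_iff] at hd
    unfold chi eps
    split_ifs <;> first | omega | simp
  have him : ((c : ℂ) * z + d).im = c * z.im := by simp
  have hneg : -(c : ℂ) * z + -d = -((c : ℂ) * z + d) := by ring
  rcases lt_trichotomy c 0 with h | h | h
  · have hlt : 0 < (-((c : ℂ) * z + d)).im := by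
      rw [Complex.neg_im, him]
      have : (c : ℝ) < 0 := by exact_mod_cast h
      nlinarith [z.im_pos]
    have h1 := neg_cpow_half_of_im_pos hlt
    rw [neg_neg] at h1
    rw [kronecker_neg_neg_of_neg h hd, h1, hneg]
    push_cast
    linear_combination (kronecker c d : ℂ) * (-((c : ℂ) * z + d)) ^ (1 / 2 : ℂ) * hE
  · have hdu : d = 1 ∨ d = -1 := by
      have := M.det_coe
      rw [Matrix.det_fin_two, ← hc, h, mul_zero, sub_zero] at this
      exact Int.isUnit_iff.mp (IsUnit.of_mul_eq_one_right _ this)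
    rcases hdu with hdu | hdu <;> rw [h, hdu] <;>
      simp [kronecker, eps, neg_one_cpow_half]
  · have hlt : 0 < ((c : ℂ) * z + d).im := by
      rw [him]; have : (0 : ℝ) < c := by exact_mod_cast h
      exact mul_pos this z.im_pos
    have h1 := neg_cpow_half_of_im_pos hlt
    rw [kronecker_neg_neg_of_pos h hd, hneg, h1]
    push_cast
    linear_combination (Complex.I * (kronecker c d : ℂ) * ((c : ℂ) * z + d) ^ (1 / 2 : ℂ)) * hE -
      (kronecker c d : ℂ) * (eps d)⁻¹ * ((c : ℂ) * z + d) ^ (1 / 2 : ℂ) * Complex.I_mul_I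

lemma det_entries (M : SL(2, ℤ)) : M 0 0 * M 1 1 - M 0 1 * M 1 0 = 1 := by
  rw [← Matrix.det_fin_two]; exact M.det_coe

/-- The automorphy factor does not change when `M` is replaced by `-M`. In half-integral weight the
sign of the Kronecker symbol and `ε_d` make up for the branch of the square root. -/
lemma autFactor_neg {k : ℤ} {M : SL(2, ℤ)} (h : 4 ∣ k ∨ (Odd k ∧ 4 ∣ M 1 0)) (z : ℍ) :
    autFactor k (-M) z = autFactor k M z := by
  rcases h with ⟨l, hl⟩ | ⟨hk, h4⟩
  · have hk : Even k := ⟨2 * l, by omega⟩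
    rw [autFactor, autFactor, if_pos hk, if_pos hk, wt_neg_eq_neg_mul_two hl, Complex.cpow_intCast,
      Complex.cpow_intCast]
    simp only [Matrix.SpecialLinearGroup.coe_neg, Matrix.neg_apply, Int.cast_neg]
    rw [show -(M 1 0 : ℂ) * z + -(M 1 1 : ℂ) = -((M 1 0 : ℂ) * z + M 1 1) by ring]
    exact Even.neg_zpow ⟨-l, by ring⟩ _
  · rw [autFactor_of_odd hk, autFactor_of_odd hk,
      thetaFactor_neg (odd_of_det h4 (det_entries M)).2]

lemma autFactor_congr {k : ℤ} {M M' : SL(2, ℤ)} (h0 : M 1 0 = M' 1 0) (h1 : M 1 1 = M' 1 1)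
    (z : ℍ) : autFactor k M z = autFactor k M' z := by
  unfold autFactor; rw [h0, h1]

lemma norm_wt_cpow {k : ℤ} (x : ℂ) :
    ‖x ^ (-wt k)‖ = ‖x‖ ^ (-((k : ℝ) / 2)) := by
  have : -wt k = ((-((k : ℝ) / 2) : ℝ) : ℂ) := by simp [wt]
  rw [this, Complex.norm_cpow_real]

lemma denom_ne_zero_of_int (M : SL(2, ℤ)) (z : ℍ) : (M 1 0 : ℂ) * z + M 1 1 ≠ 0 := by
  have := UpperHalfPlane.denom_ne_zero (M : GL (Fin 2) ℝ) z
  simpa [UpperHalfPlane.denom] using this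

lemma norm_autFactor_le {k : ℤ} {M : SL(2, ℤ)} (h : 4 ∣ k ∨ (Odd k ∧ 4 ∣ M 1 0)) (z : ℍ) :
    ‖autFactor k M z‖ ≤ ‖(M 1 0 : ℂ) * z + M 1 1‖ ^ (-((k : ℝ) / 2)) := by
  rcases h with ⟨l, hl⟩ | ⟨hk, h4⟩
  · have hk : Even k := ⟨2 * l, by omega⟩
    rw [autFactor, if_pos hk, norm_wt_cpow]
  · rw [autFactor, if_neg (Int.not_even_iff_odd.mpr hk), norm_mul, norm_mul,
      norm_wt_cpow, norm_zpow, norm_zpow, norm_eps, one_zpow, mul_one]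
    apply mul_le_of_le_one_left (by positivity)
    have h0 : k ≠ 0 := by rintro rfl; simp at hk
    rcases kronecker_trichotomy (M 1 0) (odd_of_det h4 (det_entries M)).2 with h | h | h <;>
      rw [h] <;> simp [zero_zpow, h0]

lemma coe_smul_eq (M : SL(2, ℤ)) (z : ℍ) :
    ((M • z : ℍ) : ℂ) = ((M 0 0 : ℂ) * z + M 0 1) / ((M 1 0 : ℂ) * z + M 1 1) := by
  rw [UpperHalfPlane.specialLinearGroup_apply]; simp

lemma coe_inv_smul_eq (M : SL(2, ℤ)) (z : ℍ) :
    ((M⁻¹ • z : ℍ) : ℂ) = ((M 1 1 : ℂ) * z - M 0 1) / (-(M 1 0 : ℂ) * z + M 0 0) := by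
  rw [coe_smul_eq]
  simp [Matrix.SpecialLinearGroup.coe_inv, Matrix.adjugate_fin_two, sub_eq_add_neg]

/-- The symmetry of the kernel `(w - conj z)^{-κ}` before powers are taken. -/
lemma denom_mul_sub_conj (M : SL(2, ℤ)) (w z : ℍ) :
    ((M 1 0 : ℂ) * w + M 1 1) * (((M • w : ℍ) : ℂ) - (starRingEnd ℂ) (z : ℂ)) =
      (starRingEnd ℂ) (-(M 1 0 : ℂ) * z + M 0 0) *
        ((w : ℂ) - (starRingEnd ℂ) ((M⁻¹ • z : ℍ) : ℂ)) := by
  have h1 := denom_ne_zero_of_int M w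
  have h2 : (starRingEnd ℂ) (-(M 1 0 : ℂ) * z + M 0 0) ≠ 0 := by
    rw [map_ne_zero]
    have := denom_ne_zero_of_int M⁻¹ z
    simpa [Matrix.SpecialLinearGroup.coe_inv, Matrix.adjugate_fin_two] using this
  rw [mul_sub, mul_sub, coe_smul_eq, mul_div_cancel₀ _ h1, coe_inv_smul_eq, map_div₀,
    mul_div_cancel₀ _ h2]
  simp only [map_add, map_sub, map_mul, map_neg, map_intCast]
  ring

lemma im_sub_conj_pos (w z : ℍ) : 0 < ((w : ℂ) - (starRingEnd ℂ) (z : ℂ)).im := by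
  have h1 := w.im_pos
  have h2 := z.im_pos
  simp; linarith

/-- The symmetry of the kernel `(w - conj z)^{-1/2}` with the theta multiplier. For `c ≠ 0` the factor
`cw + d` and the conjugate of `-cz + a` lie in the same half-plane, so that no branch is crossed; for
`c = 0`, `d = -1` the factor `ε_{-1}` corrects the branch. -/
lemma thetaFactor_symm {M : SL(2, ℤ)} (h4 : 4 ∣ M 1 0) (w z : ℍ) :
    thetaFactor M w * (((M • w : ℍ) : ℂ) - (starRingEnd ℂ) (z : ℂ)) ^ (1 / 2 : ℂ) =
      (starRingEnd ℂ) (thetaFactor M⁻¹ z) *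
        ((w : ℂ) - (starRingEnd ℂ) ((M⁻¹ • z : ℍ) : ℂ)) ^ (1 / 2 : ℂ) := by
  have hdet := det_entries M
  have hpp := denom_mul_sub_conj M w z
  have i2 := im_sub_conj_pos (M • w) z
  have i3 := im_sub_conj_pos w (M⁻¹ • z)
  have hn4 := denom_ne_zero_of_int M⁻¹ z
  have hn1 := denom_ne_zero_of_int M w
  unfold thetaFactor
  simp only [Matrix.SpecialLinearGroup.coe_inv, Matrix.adjugate_fin_two, Matrix.of_apply,
    Matrix.cons_val_zero, Matrix.cons_val_one, Matrix.cons_val', Matrix.cons_val_fin_one,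
    Int.cast_neg] at hn4 ⊢
  set Z2 := ((M • w : ℍ) : ℂ) - (starRingEnd ℂ) (z : ℂ)
  set Z3 := (w : ℂ) - (starRingEnd ℂ) ((M⁻¹ • z : ℍ) : ℂ)
  set a := M 0 0
  set c := M 1 0
  set d := M 1 1
  have hhalf : (starRingEnd ℂ) (1 / 2 : ℂ) = 1 / 2 := by rw [map_div₀, map_one, map_ofNat]
  by_cases hc : c = 0
  · have hdu : (a = 1 ∧ d = 1) ∨ (a = -1 ∧ d = -1) := by
      rw [hc, mul_zero, sub_zero] at hdet
      exact Int.mul_eq_one_iff_eq_one_or_neg_one.mp hdet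
    have h23 : Z2 = Z3 := by
      rcases hdu with ⟨h1, h2⟩ | ⟨h1, h2⟩ <;> rw [hc, h1, h2] at hpp <;> simpa using hpp
    rw [h23]
    rcases hdu with ⟨h1, h2⟩ | ⟨h1, h2⟩ <;> rw [hc, h1, h2] <;>
      simp [kronecker, eps, neg_one_cpow_half]
  · have i4 : (-(c : ℂ) * z + a).im = -c * z.im := by simp
    have i1 : ((c : ℂ) * w + d).im = c * w.im := by simp
    have hcr : (c : ℝ) ≠ 0 := by exact_mod_cast hc
    have i4' : (-(c : ℂ) * z + a).im ≠ 0 := by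
      rw [i4]; exact mul_ne_zero (neg_ne_zero.mpr hcr) z.im_pos.ne'
    have hcp := cpow_conj_of_im_ne_zero i4' hhalf
    set Z1 := (c : ℂ) * w + d
    set Z4 := (starRingEnd ℂ) (-(c : ℂ) * z + a) with hZ4
    have hZ4im : Z4.im = c * z.im := by rw [hZ4, Complex.conj_im, i4]; ring
    have hprod : Z1 ^ (1 / 2 : ℂ) * Z2 ^ (1 / 2 : ℂ) = Z4 ^ (1 / 2 : ℂ) * Z3 ^ (1 / 2 : ℂ) := by
      have a2 := arg_mem_of_im_pos i2
      have a3 := arg_mem_of_im_pos i3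
      have n4 : Z4 ≠ 0 := by rw [hZ4, map_ne_zero]; exact hn4
      rcases lt_or_gt_of_ne hcr with h | h
      · have a1 := arg_mem_of_im_neg (z := Z1) (by rw [i1]; nlinarith [w.im_pos])
        have a4 := arg_mem_of_im_neg (z := Z4) (by rw [hZ4im]; nlinarith [z.im_pos])
        exact cpow_mul_cpow_eq hn1 (ne_zero_of_im_ne_zero i2.ne') n4
          (ne_zero_of_im_ne_zero i3.ne') hpp (by linarith) (by linarith) _
      · have a1 := arg_mem_of_im_pos (z := Z1) (by rw [i1]; exact mul_pos h w.im_pos)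
        have a4 := arg_mem_of_im_pos (z := Z4) (by rw [hZ4im]; exact mul_pos h z.im_pos)
        exact cpow_mul_cpow_eq hn1 (ne_zero_of_im_ne_zero i2.ne') n4
          (ne_zero_of_im_ne_zero i3.ne') hpp (by linarith) (by linarith) _
    have hk : (kronecker c d : ℂ) = kronecker (-c) a * (eps d * eps d) := by
      rw [eps_mul_self, kronecker_inv hc h4 hdet]; push_cast; ring
    have he : (starRingEnd ℂ) (eps a)⁻¹ = eps d := by
      rw [eps_eq_of_chi (chi_eq_of_det h4 hdet)]
      unfold eps; split_ifs <;> simp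
    rw [map_mul, map_mul, hcp, he, map_intCast, hk, mul_assoc, hprod]
    have := eps_ne_zero d
    field_simp

/-- The kernel `(w - conj z)^{-κ}`: the slash action of `M` in `w` is the conjugate of the slash action
of `M⁻¹` in `z`. -/
lemma autFactor_symm {k : ℤ} {M : SL(2, ℤ)} (h : 4 ∣ k ∨ (Odd k ∧ 4 ∣ M 1 0)) (w z : ℍ) :
    autFactor k M w * (((M • w : ℍ) : ℂ) - (starRingEnd ℂ) (z : ℂ)) ^ (-wt k) =
      (starRingEnd ℂ) (autFactor k M⁻¹ z) *
        ((w : ℂ) - (starRingEnd ℂ) ((M⁻¹ • z : ℍ) : ℂ)) ^ (-wt k) := by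
  rcases h with ⟨l, hl⟩ | ⟨hk, h4⟩
  · have hk : Even k := ⟨2 * l, by omega⟩
    rw [autFactor, autFactor, if_pos hk, if_pos hk, wt_neg_eq_neg_mul_two hl]
    simp only [Complex.cpow_intCast]
    rw [map_zpow₀, ← mul_zpow, ← mul_zpow, denom_mul_sub_conj]
    simp [Matrix.SpecialLinearGroup.coe_inv, Matrix.adjugate_fin_two]
  · rw [autFactor_of_odd hk, autFactor_of_odd hk, ← cpow_half_zpow, ← cpow_half_zpow, map_zpow₀,
      ← mul_zpow, ← mul_zpow, thetaFactor_symm h4]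

section

open Filter Topology FourierTransform Convolution

/-! ### The Gamma kernel and its Fourier transform -/

/-- The function `s ↦ s^p e^{-rs}` on the positive half-line. Replacing `s^p` by `max(s, 0)^p` extends it
by zero, continuously, when `p > 0`. -/
def gammaKernel (p : ℝ) (r : ℂ) (s : ℝ) : ℂ := (((max s 0) ^ p : ℝ) : ℂ) * Complex.exp (-(r * s))

lemma gammaKernel_of_nonpos {p : ℝ} (hp : 0 < p) (r : ℂ) {s : ℝ} (hs : s ≤ 0) :
    gammaKernel p r s = 0 := by
  simp [gammaKernel, max_eq_right hs, Real.zero_rpow hp.ne']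

lemma gammaKernel_of_pos (p : ℝ) (r : ℂ) {s : ℝ} (hs : 0 < s) :
    gammaKernel p r s = ((s ^ p : ℝ) : ℂ) * Complex.exp (-(r * s)) := by
  rw [gammaKernel, max_eq_left hs.le]

lemma norm_gammaKernel (p : ℝ) (r : ℂ) (s : ℝ) :
    ‖gammaKernel p r s‖ = (max s 0) ^ p * Real.exp (-r.re * s) := by
  have : 0 ≤ (max s 0) ^ p := Real.rpow_nonneg (le_max_right _ _) _
  rw [gammaKernel, norm_mul, Complex.norm_exp, Complex.norm_real, Real.norm_of_nonneg this]
  simp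

lemma continuous_gammaKernel {p : ℝ} (hp : 0 < p) (r : ℂ) : Continuous (gammaKernel p r) := by
  unfold gammaKernel
  have : Continuous fun s : ℝ ↦ (max s 0) ^ p :=
    (continuous_id.max continuous_const).rpow_const fun _ ↦ Or.inr hp.le
  fun_prop

lemma integrableOn_rpow_mul_exp {p a : ℝ} (hp : 0 < p) (ha : 0 < a) :
    IntegrableOn (fun s : ℝ ↦ s ^ p * Real.exp (-a * s)) (Ioi 0) := by
  simpa using integrableOn_rpow_mul_exp_neg_mul_rpow (p := 1) (s := p) (b := a) (by linarith)
    one_pos ha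

lemma integrable_gammaKernel {p : ℝ} (hp : 0 < p) {r : ℂ} (hr : 0 < r.re) :
    Integrable (gammaKernel p r) := by
  have h : IntegrableOn (gammaKernel p r) (Ioi 0) := by
    refine (integrableOn_rpow_mul_exp hp hr).mono'
      (continuous_gammaKernel hp r).aestronglyMeasurable ?_
    refine (ae_restrict_iff' measurableSet_Ioi).mpr (ae_of_all _ fun s hs ↦ ?_)
    rw [norm_gammaKernel, max_eq_left (le_of_lt hs)]
  refine (integrableOn_iff_integrable_of_support_subset fun s hs ↦ ?_).mp h
  by_contra hs'
  exact hs (gammaKernel_of_nonpos hp r (not_lt.mp hs'))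

lemma isBigO_atTop_gammaKernel {p : ℝ} {r : ℂ} (hr : 0 < r.re) (b : ℝ) :
    gammaKernel p r =O[atTop] fun x : ℝ ↦ x ^ b := by
  have h := (isLittleO_exp_neg_mul_rpow_atTop hr (b - p)).isBigO
  have h2 := (Asymptotics.isBigO_refl (fun s : ℝ ↦ s ^ p) atTop).mul h
  refine Asymptotics.IsBigO.trans (Asymptotics.IsBigO.of_bound 1 ?_) h2 |>.trans
    (Asymptotics.IsBigO.of_bound 1 ?_)
  · filter_upwards [eventually_gt_atTop 0] with s hs
    rw [norm_gammaKernel, max_eq_left hs.le, one_mul, Real.norm_of_nonneg (by positivity)]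
  · filter_upwards [eventually_gt_atTop 0] with s hs
    rw [← Real.rpow_add hs, one_mul, add_sub_cancel]

lemma isBigO_cocompact_gammaKernel {p : ℝ} (hp : 0 < p) {r : ℂ} (hr : 0 < r.re) (b : ℝ) :
    gammaKernel p r =O[cocompact ℝ] fun x : ℝ ↦ |x| ^ b := by
  rw [cocompact_eq_atBot_atTop, Asymptotics.isBigO_sup]
  constructor
  · refine Asymptotics.IsBigO.of_bound 1 ?_
    filter_upwards [eventually_le_atBot 0] with s hs
    rw [gammaKernel_of_nonpos hp r hs, norm_zero]; positivity
  · refine (isBigO_atTop_gammaKernel hr b).trans (Asymptotics.IsBigO.of_bound 1 ?_)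
    filter_upwards [eventually_gt_atTop 0] with s hs
    rw [abs_of_pos hs, one_mul]

lemma bddAbove_gammaKernel {p : ℝ} (hp : 0 < p) {r : ℂ} (hr : 0 < r.re) :
    BddAbove (range fun x ↦ ‖gammaKernel p r x‖) := by
  have h0 : Tendsto (fun x ↦ ‖gammaKernel p r x‖) (cocompact ℝ) (𝓝 0) := by
    rw [tendsto_zero_iff_norm_tendsto_zero.symm]
    refine (isBigO_cocompact_gammaKernel hp hr (-1)).trans_tendsto ?_
    have := tendsto_norm_cocompact_atTop (E := ℝ)
    simpa [Function.comp_def] using (tendsto_rpow_neg_atTop one_pos).comp this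
  have hc := (continuous_gammaKernel hp r).norm
  obtain ⟨t, ht, ht'⟩ := (hasBasis_cocompact.eventually_iff).mp (h0.eventually_le_const one_pos)
  obtain ⟨C, hC⟩ := ht.bddAbove_image hc.continuousOn
  refine ⟨max C 1, ?_⟩
  rintro _ ⟨x, rfl⟩
  by_cases hx : x ∈ t
  · exact (hC ⟨x, hx, rfl⟩).trans (le_max_left _ _)
  · exact (ht' hx).trans (le_max_right _ _)

/-- Euler's integral `∫ s^p e^{-rs} ds = Γ(p + 1) r^{-p-1}` for complex `r` with `Re r > 0`, by
analytic continuation from real `r`. -/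
lemma integral_gammaKernel {p : ℝ} (hp : 0 < p) {r : ℂ} (hr : 0 < r.re) :
    ∫ s, gammaKernel p r s = Complex.Gamma (p + 1) * r ^ (-((p : ℂ) + 1)) := by
  -- The integral is the moment-generating function of `s ↦ -s` for the measure `s^p ds` on `s > 0`;
  -- such functions are analytic in the interior of their strip of convergence.
  let μ : Measure ℝ := (volume.restrict (Ioi 0)).withDensity fun s ↦ ENNReal.ofReal (s ^ p)
  let X : ℝ → ℝ := fun s ↦ -s
  have hm : Measurable fun s : ℝ ↦ ENNReal.ofReal (s ^ p) := by fun_prop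
  have hlt : ∀ᵐ s ∂(volume.restrict (Ioi (0 : ℝ))), ENNReal.ofReal (s ^ p) < ⊤ :=
    ae_of_all _ fun s ↦ ENNReal.ofReal_lt_top
  have hmgf : ∀ r : ℂ, ProbabilityTheory.complexMGF X μ r = ∫ s, gammaKernel p r s := by
    intro r
    rw [ProbabilityTheory.complexMGF, integral_withDensity_eq_integral_toReal_smul hm hlt,
      ← setIntegral_eq_integral_of_forall_compl_eq_zero (f := gammaKernel p r) (s := Ioi (0 : ℝ))]
    · refine setIntegral_congr_fun measurableSet_Ioi fun s hs ↦ ?_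
      have hs' : (0 : ℝ) ≤ s ^ p := Real.rpow_nonneg (le_of_lt hs) _
      simp only [X, gammaKernel_of_pos p r hs]
      rw [ENNReal.toReal_ofReal hs', Complex.real_smul]
      congr 2; push_cast; ring
    · exact fun s hs ↦ gammaKernel_of_nonpos hp r (not_lt.mp hs)
  have hset : Ioi (0 : ℝ) ⊆ interior (ProbabilityTheory.integrableExpSet X μ) := by
    rw [isOpen_Ioi.subset_interior_iff]
    intro t ht
    change Integrable _ _
    rw [integrable_withDensity_iff_integrable_smul₀' hm.aemeasurable hlt]
    refine (integrableOn_rpow_mul_exp hp ht).congr_fun (fun s hs ↦ ?_) measurableSet_Ioi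
    have hs' : (0 : ℝ) ≤ s ^ p := Real.rpow_nonneg (le_of_lt hs) _
    simp only [X, ENNReal.toReal_ofReal hs', smul_eq_mul]
    congr 2; ring
  have hreal : ∀ t : ℝ, 0 < t →
      ∫ s, gammaKernel p t s = Complex.Gamma (p + 1) * (t : ℂ) ^ (-((p : ℂ) + 1)) := by
    intro t ht
    rw [← setIntegral_eq_integral_of_forall_compl_eq_zero (s := Ioi (0 : ℝ))
      (fun s hs ↦ gammaKernel_of_nonpos hp t (not_lt.mp hs))]
    have := Complex.integral_cpow_mul_exp_neg_mul_Ioi (a := p + 1) (r := t)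
      (by simp; linarith) ht
    rw [Complex.cpow_neg, ← Complex.inv_cpow _ _ (by
      rw [Complex.arg_ofReal_of_nonneg ht.le]; exact Real.pi_pos.ne), mul_comm, ← one_div, ← this]
    refine setIntegral_congr_fun measurableSet_Ioi fun s hs ↦ ?_
    simp only [gammaKernel_of_pos p _ hs]
    rw [Complex.ofReal_cpow (le_of_lt hs), add_sub_cancel_right]
  have key : EqOn (ProbabilityTheory.complexMGF X μ)
      (fun r ↦ Complex.Gamma (p + 1) * r ^ (-((p : ℂ) + 1))) {z : ℂ | 0 < z.re} := by
    refine AnalyticOnNhd.eqOn_of_preconnected_of_frequently_eq (z₀ := 1)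
      (ProbabilityTheory.analyticOnNhd_complexMGF.mono fun z hz ↦ hset hz) ?_
      (convex_halfSpace_re_gt 0).isPreconnected (by simp) ?_
    · intro z hz
      exact analyticAt_const.mul (analyticAt_id.cpow analyticAt_const (Or.inl hz))
    · have ht : Tendsto (fun x : ℝ ↦ (x : ℂ)) (𝓝[>] 1) (𝓝[≠] 1) := by
        refine tendsto_nhdsWithin_iff.mpr ⟨?_, ?_⟩
        · exact (Complex.continuous_ofReal.tendsto' 1 1 (by simp)).mono_left nhdsWithin_le_nhds
        · filter_upwards [self_mem_nhdsWithin] with x hx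
          have : x ≠ 1 := ne_of_gt hx
          simpa using this
      refine ht.frequently (Eventually.frequently ?_)
      filter_upwards [self_mem_nhdsWithin] with x hx
      have hx : (1 : ℝ) < x := hx
      rw [hmgf, hreal x (by linarith)]
  rw [← hmgf]
  exact key hr

lemma fourier_gammaKernel {p : ℝ} (hp : 0 < p) {r : ℂ} (hr : 0 < r.re) (ξ : ℝ) :
    𝓕 (gammaKernel p r) ξ =
      Complex.Gamma (p + 1) * (r + 2 * π * Complex.I * ξ) ^ (-((p : ℂ) + 1)) := by
  rw [← integral_gammaKernel hp (by simpa using hr), Real.fourier_real_eq_integral_exp_smul]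
  refine integral_congr_ae (ae_of_all _ fun s ↦ ?_)
  simp only [gammaKernel, smul_eq_mul]
  rw [mul_left_comm, ← Complex.exp_add]
  congr 2; push_cast; ring

end

section

open Filter Topology FourierTransform Convolution

/-! ### The Lipschitz summation formula -/

/-- The sums `∑ |w - m|^{-κ}` over `m ∈ ℤ` are bounded uniformly on half-planes `Im w ≥ v`. -/
lemma exists_tsum_norm_sub_int_le {κ : ℝ} (hκ : 2 < κ) {v : ℝ} (hv : 0 < v) :
    ∃ C : ℝ, ∀ w : ℂ, v ≤ w.im → Summable (fun m : ℤ ↦ ‖w - m‖ ^ (-κ)) ∧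
      ∑' m : ℤ, ‖w - m‖ ^ (-κ) ≤ C := by
  let R := EisensteinSeries.r ⟨⟨1, v⟩, hv⟩
  have hinj : Function.Injective fun m : ℤ ↦ (![1, -m] : Fin 2 → ℤ) := by
    intro a b hab
    simpa using congrFun hab 1
  have hS := ((EisensteinSeries.summable_one_div_norm_rpow hκ).comp_injective hinj).mul_left
    (R ^ (-κ))
  refine ⟨∑' m : ℤ, R ^ (-κ) * ‖(![1, -m] : Fin 2 → ℤ)‖ ^ (-κ), fun w hw ↦ ?_⟩
  -- An integral translation moves `w` into the strip `0 ≤ Re w < 1`.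
  have hpos : 0 < (w - (⌊w.re⌋ : ℂ)).im := by simpa using hv.trans_le hw
  let z : ℍ := ⟨w - (⌊w.re⌋ : ℂ), hpos⟩
  have hz : z ∈ verticalStrip 1 v := by
    rw [mem_verticalStrip_iff]
    constructor
    · change |(w - (⌊w.re⌋ : ℂ)).re| ≤ 1
      rw [Complex.sub_re, Complex.intCast_re, abs_of_nonneg (sub_nonneg.mpr (Int.floor_le _))]
      linarith [Int.lt_floor_add_one w.re]
    · change v ≤ (w - (⌊w.re⌋ : ℂ)).im
      simpa using hw
  have hb : ∀ m : ℤ, ‖(z : ℂ) - m‖ ^ (-κ) ≤ R ^ (-κ) * ‖(![1, -m] : Fin 2 → ℤ)‖ ^ (-κ) := by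
    intro m
    have := EisensteinSeries.summand_bound_of_mem_verticalStrip (k := κ) (by linarith) ![1, -m] hv hz
    simpa [sub_eq_add_neg] using this
  have hs : Summable fun m : ℤ ↦ ‖(z : ℂ) - m‖ ^ (-κ) :=
    Summable.of_nonneg_of_le (fun m ↦ by positivity) hb hS
  have he : (fun m : ℤ ↦ ‖(z : ℂ) - m‖ ^ (-κ)) =
      (fun m : ℤ ↦ ‖w - m‖ ^ (-κ)) ∘ Equiv.addLeft ⌊w.re⌋ := by
    ext m
    simp only [Function.comp, Equiv.coe_addLeft, z]
    push_cast
    rw [sub_sub]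
  refine ⟨(Equiv.addLeft ⌊w.re⌋).summable_iff.mp (he ▸ hs), ?_⟩
  rw [← (Equiv.addLeft ⌊w.re⌋).tsum_eq fun m : ℤ ↦ ‖w - m‖ ^ (-κ)]
  change ∑' m, ((fun m : ℤ ↦ ‖w - m‖ ^ (-κ)) ∘ Equiv.addLeft ⌊w.re⌋) m ≤ _
  rw [← he]
  exact hs.tsum_le_tsum hb hS

lemma norm_cpow_neg_ofReal (x : ℂ) (κ : ℝ) : ‖x ^ (-(κ : ℂ))‖ = ‖x‖ ^ (-κ) := by
  rw [← Complex.ofReal_neg, Complex.norm_cpow_real]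

/-- `(-2πi w)^{-κ} = (-2πi)^{-κ} w^{-κ}` in the upper half-plane. -/
lemma two_pi_neg_I_mul_cpow {w : ℂ} (hw : 0 < w.im) (s : ℂ) :
    (-2 * π * Complex.I * w) ^ s = (-2 * π * Complex.I) ^ s * w ^ s := by
  have hπ := Real.pi_pos
  have h0 : (-2 * π * Complex.I : ℂ) ≠ 0 := by simp [hπ.ne']
  have hz := ne_zero_of_im_ne_zero hw.ne'
  have harg : (-2 * π * Complex.I : ℂ).arg = -(π / 2) := by
    rw [show (-2 * π * Complex.I : ℂ) = ((2 * π : ℝ) : ℂ) * -Complex.I by push_cast; ring,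
      Complex.arg_real_mul _ (by positivity), Complex.arg_neg_I]
  have ha := arg_mem_of_im_pos hw
  have hb := Complex.neg_pi_lt_arg (-2 * π * Complex.I * w)
  have hb' := Complex.arg_le_pi (-2 * π * Complex.I * w)
  have := cpow_mul_cpow_eq h0 hz (mul_ne_zero h0 hz) one_ne_zero (mul_one _).symm
    (by rw [harg, Complex.arg_one]; linarith) (by rw [harg, Complex.arg_one]; linarith) s
  rw [this, Complex.one_cpow, mul_one]

lemma fourier_gammaKernel_upperHalfPlane {κ : ℝ} (hκ : 1 < κ) {w : ℂ} (hw : 0 < w.im) (x : ℝ) :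
    𝓕 (gammaKernel (κ - 1) (-2 * π * Complex.I * w)) x =
      Complex.Gamma κ * (-2 * π * Complex.I) ^ (-(κ : ℂ)) * (w - x) ^ (-(κ : ℂ)) := by
  have hr : 0 < (-2 * π * Complex.I * w).re := by simpa using by positivity
  rw [fourier_gammaKernel (by linarith) hr]
  have e : -2 * π * Complex.I * w + 2 * π * Complex.I * x = -2 * π * Complex.I * (w - x) := by ring
  rw [e, two_pi_neg_I_mul_cpow (by simpa using hw)]
  push_cast
  rw [sub_add_cancel]
  ring

/-- The Lipschitz formula
`Γ(κ) (-2πi)^{-κ} ∑_{m ∈ ℤ} (w - m)^{-κ} = ∑_{n ≥ 1} n^{κ-1} e^{2πinw}`, an instance of Poisson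
summation for the Gamma kernel. -/
lemma lipschitz_summation {κ : ℝ} (hκ : 2 < κ) {w : ℂ} (hw : 0 < w.im) :
    Complex.Gamma κ * (-2 * π * Complex.I) ^ (-(κ : ℂ)) * ∑' m : ℤ, (w - m) ^ (-(κ : ℂ)) =
      ∑' n : ℕ+, (((n : ℝ) ^ (κ - 1) : ℝ) : ℂ) * Complex.exp (2 * π * Complex.I * n * w) := by
  have hr : 0 < (-2 * π * Complex.I * w).re := by simpa using by positivity
  obtain ⟨C, hC⟩ := exists_tsum_norm_sub_int_le hκ hw
  have hs : Summable fun m : ℤ ↦ (w - m) ^ (-(κ : ℂ)) := by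
    refine Summable.of_norm ?_
    simpa only [norm_cpow_neg_ofReal] using (hC w le_rfl).1
  have hF : ∀ m : ℤ, 𝓕 (gammaKernel (κ - 1) (-2 * π * Complex.I * w)) m =
      Complex.Gamma κ * (-2 * π * Complex.I) ^ (-(κ : ℂ)) * (w - m) ^ (-(κ : ℂ)) := fun m ↦ by
    simpa using fourier_gammaKernel_upperHalfPlane (by linarith : 1 < κ) hw m
  have hP := Real.tsum_eq_tsum_fourier_of_rpow_decay_of_summable
    (continuous_gammaKernel (by linarith : 0 < κ - 1) _) one_lt_two
    (isBigO_cocompact_gammaKernel (by linarith : 0 < κ - 1) hr (-2))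
    (by simp only [hF]; exact hs.mul_left _) 0
  simp only [hF, zero_add] at hP
  have h1 : ∀ n : ℤ, (fourier n) ((0 : ℝ) : UnitAddCircle) = 1 := fun n ↦ by
    rw [fourier_coe_apply]; simp
  simp only [h1, mul_one] at hP
  rw [← tsum_mul_left, ← hP]
  have hinj : Function.Injective fun n : ℕ+ ↦ ((n : ℕ) : ℤ) := fun a b h ↦ by
    exact PNat.eq (Int.ofNat.inj h)
  rw [← hinj.tsum_eq]
  · refine tsum_congr fun n ↦ ?_
    have hn : (0 : ℝ) < (((n : ℕ) : ℤ) : ℝ) := by exact_mod_cast n.pos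
    rw [gammaKernel_of_pos _ _ hn]
    push_cast
    congr 2
    ring
  · intro n hn
    rcases le_or_gt n 0 with h | h
    · exact absurd (gammaKernel_of_nonpos (by linarith) _ (by exact_mod_cast h)) hn
    · exact ⟨⟨n.toNat, by omega⟩, by simp; omega⟩

/-! ### The integrals along horizontal lines -/

lemma norm_add_mul_I_ge {m β : ℝ} (hm : 0 < m) (hβ : m ≤ |β|) (x : ℝ) :
    m / (1 + m) * (1 + ‖x‖) ≤ ‖(x : ℂ) + β * Complex.I‖ := by
  have h1 : |x| ≤ ‖(x : ℂ) + β * Complex.I‖ := by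
    simpa using Complex.abs_re_le_norm ((x : ℂ) + β * Complex.I)
  have h2 : |β| ≤ ‖(x : ℂ) + β * Complex.I‖ := by
    simpa using Complex.abs_im_le_norm ((x : ℂ) + β * Complex.I)
  rw [div_mul_eq_mul_div, div_le_iff₀ (by linarith), Real.norm_eq_abs]
  nlinarith

/-- The factor `(t + 2iy)^{1-κ} / t` of the integrand of `lineIntegral`, at `t = x + iα`. -/
def lineKernel (κ y α x : ℝ) : ℂ :=
  (((x : ℂ) + α * Complex.I) + 2 * Complex.I * y) ^ (-((κ : ℂ) - 1)) / ((x : ℂ) + α * Complex.I)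

lemma integrable_lineKernel {κ : ℝ} (hκ : 2 < κ) {y α : ℝ} (hα : -2 * y < α) (hα' : α < 0) :
    Integrable (lineKernel κ y α) := by
  set m := min (-α) (α + 2 * y)
  have hm : 0 < m := lt_min (by linarith) (by linarith)
  have e1 : ∀ x : ℝ, (((x : ℂ) + α * Complex.I) + 2 * Complex.I * y) =
      x + ((α + 2 * y : ℝ) : ℂ) * Complex.I := fun x ↦ by push_cast; ring
  have hc : 0 < m / (1 + m) := by positivity
  have hcont : Continuous (lineKernel κ y α) := by
    refine Continuous.div (Continuous.cpow (by fun_prop) continuous_const fun x ↦ ?_)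
      (by fun_prop) fun x ↦ ne_zero_of_im_ne_zero (by simpa using hα'.ne)
    right
    rw [e1]
    simp; linarith
  refine ((integrable_one_add_norm (μ := volume) (E := ℝ) (r := κ)
    (by simp; linarith)).const_mul ((m / (1 + m)) ^ (-κ))).mono'
    hcont.aestronglyMeasurable (ae_of_all _ fun x ↦ ?_)
  have b1 : m / (1 + m) * (1 + ‖x‖) ≤ ‖(x : ℂ) + α * Complex.I‖ :=
    norm_add_mul_I_ge hm (by rw [abs_of_neg hα']; exact min_le_left _ _) x
  have b2 : m / (1 + m) * (1 + ‖x‖) ≤ ‖(x : ℂ) + ((α + 2 * y : ℝ) : ℂ) * Complex.I‖ :=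
    norm_add_mul_I_ge hm (by rw [abs_of_pos (by linarith)]; exact min_le_right _ _) x
  have hb : 0 < m / (1 + m) * (1 + ‖x‖) := by positivity
  have e2 : -((κ : ℂ) - 1) = -((κ - 1 : ℝ) : ℂ) := by push_cast; ring
  rw [lineKernel, norm_div, e1, e2, norm_cpow_neg_ofReal, ← Real.mul_rpow hc.le (by positivity),
    show -κ = -(κ - 1) - 1 by ring, Real.rpow_sub_one hb.ne']
  have b3 := Real.rpow_le_rpow_of_nonpos hb b2 (show -(κ - 1) ≤ 0 by linarith)
  exact div_le_div₀ (by positivity) b3 hb b1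

lemma lineIntegrand_eq (k : ℤ) (n : ℕ+) (y α x : ℝ) :
    lineIntegrand k (-(n : ℤ)) y α x =
      Complex.exp (2 * π * n * α) *
        (Complex.exp (-2 * π * Complex.I * n * x) * lineKernel ((k : ℝ) / 2) y α x) := by
  have e : Complex.exp (2 * π * Complex.I * ((-(n : ℤ) : ℤ) : ℂ) * (x + α * Complex.I)) =
      Complex.exp (2 * π * n * α) * Complex.exp (-2 * π * Complex.I * n * x) := by
    rw [← Complex.exp_add]
    congr 1
    push_cast
    linear_combination (-2 * π * n * α) * Complex.I_mul_I
  rw [lineIntegrand, e, lineKernel, Complex.cpow_neg, wt]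
  push_cast
  simp only [div_eq_mul_inv]
  ring

lemma integrable_exp_mul_lineKernel {κ : ℝ} (hκ : 2 < κ) {y α : ℝ} (hα : -2 * y < α) (hα' : α < 0)
    (n : ℕ+) :
    Integrable fun x : ℝ ↦ Complex.exp (-2 * π * Complex.I * n * x) * lineKernel κ y α x := by
  refine (integrable_lineKernel hκ hα hα').bdd_mul (c := 1) (by fun_prop) (ae_of_all _ fun x ↦ ?_)
  rw [Complex.norm_exp]; simp

lemma integrable_lineIntegrand {k : ℤ} (hk : 4 < k) {y α : ℝ} (hα : -2 * y < α) (hα' : α < 0)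
    (n : ℕ+) : Integrable (lineIntegrand k (-(n : ℤ)) y α) := by
  have hκ : 2 < (k : ℝ) / 2 := by
    have : (4 : ℝ) < k := by exact_mod_cast hk
    linarith
  simp_rw [funext (lineIntegrand_eq k n y α)]
  exact (integrable_exp_mul_lineKernel hκ hα hα' n).const_mul _

/-- The exponential `v ↦ e^{-2παv}` on the negative half-line, for `α < 0`. -/
def expKernel (α v : ℝ) : ℂ := (Iic (0 : ℝ)).indicator (fun v ↦ Complex.exp (-2 * π * α * v)) v

lemma integrable_expKernel {α : ℝ} (hα : α < 0) : Integrable (expKernel α) := by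
  have := integrableOn_exp_mul_complex_Iic (a := -2 * π * α)
    (by have := Real.pi_pos; simp; nlinarith) 0
  exact (integrable_indicator_iff measurableSet_Iic).mpr this

lemma fourier_expKernel {α : ℝ} (hα : α < 0) (ξ : ℝ) :
    𝓕 (expKernel α) ξ = (-2 * π * (α + Complex.I * ξ))⁻¹ := by
  have := integral_exp_mul_complex_Iic (a := -2 * π * (α + Complex.I * ξ))
    (by have := Real.pi_pos; simp; nlinarith) 0
  rw [Real.fourier_real_eq_integral_exp_smul]
  rw [Complex.ofReal_zero, mul_zero, Complex.exp_zero, one_div] at this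
  rw [← this, ← integral_indicator measurableSet_Iic]
  refine integral_congr_ae (ae_of_all _ fun v ↦ ?_)
  by_cases hv : v ∈ Iic (0 : ℝ)
  · simp only [expKernel, indicator_of_mem hv, smul_eq_mul]
    rw [← Complex.exp_add]
    congr 1; push_cast; ring
  · simp [expKernel, indicator_of_notMem hv]

/-- The integral over the line `Im t = α` is an incomplete Gamma integral. The kernel
`(t + 2iy)^{1-κ} / t` is, up to a constant, the Fourier transform of the convolution of a Gamma kernel
with an exponential, and Fourier inversion recovers that convolution at `n`. -/
lemma integral_exp_mul_lineKernel {κ : ℝ} (hκ : 2 < κ) {y α : ℝ} (hα : -2 * y < α) (hα' : α < 0)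
    (n : ℕ+) :
    Complex.exp (2 * π * n * α) *
        ∫ x : ℝ, Complex.exp (-2 * π * Complex.I * n * x) * lineKernel κ y α x =
      2 * π * Complex.I * (-2 * π * Complex.I) ^ ((κ : ℂ) - 1) / Complex.Gamma ((κ : ℂ) - 1) *
        ∫ s in Ioi (n : ℝ), ((s ^ (κ - 2) : ℝ) : ℂ) * Complex.exp (-(4 * π * y * s)) := by
  have hπ := Real.pi_pos
  have hp : 0 < κ - 2 := by linarith
  -- The factor `e^{-2παs}` is moved from the Gamma kernel to the exponential, so that both functions
  -- are integrable; this is where `-2y < α < 0` is used.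
  let r : ℂ := ((4 * π * y + 2 * π * α : ℝ) : ℂ)
  have hr : 0 < r.re := by
    simp only [r, Complex.ofReal_re]; nlinarith
  let A := gammaKernel (κ - 2) r
  let B := expKernel α
  have hA : Integrable A := integrable_gammaKernel hp hr
  have hB : Integrable B := integrable_expKernel hα'
  let φ : ℝ → ℂ := A ⋆[ContinuousLinearMap.mul ℂ ℂ] B
  have hφc : Continuous φ :=
    (bddAbove_gammaKernel hp hr).continuous_convolution_left_of_integrable _
      (continuous_gammaKernel hp r) hB
  have hφi : Integrable φ := hA.integrable_convolution _ hB
  let D : ℂ := Complex.Gamma ((κ : ℂ) - 1) * (-2 * π * Complex.I) ^ (-((κ : ℂ) - 1)) *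
    (2 * π * Complex.I)⁻¹
  have hFφ : ∀ ξ : ℝ, 𝓕 φ ξ = D * lineKernel κ y α (-ξ) := by
    intro ξ
    have h1 : 𝓕 φ ξ = 𝓕 A ξ * 𝓕 B ξ := Real.fourier_mul_convolution_eq hA hB ξ
    rw [h1, fourier_gammaKernel hp hr, fourier_expKernel hα', lineKernel]
    have e1 : r + 2 * π * Complex.I * ξ =
        -2 * π * Complex.I * (((-ξ : ℝ) : ℂ) + α * Complex.I + 2 * Complex.I * y) := by
      simp only [r]; push_cast
      linear_combination (2 * π * α + 4 * π * y) * Complex.I_mul_I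
    have e2 : -2 * π * ((α : ℂ) + Complex.I * ξ) =
        2 * π * Complex.I * (((-ξ : ℝ) : ℂ) + α * Complex.I) := by
      push_cast
      linear_combination (-2 * π * α) * Complex.I_mul_I
    rw [e1, e2, two_pi_neg_I_mul_cpow (by simp; linarith), mul_inv]
    push_cast
    rw [show (κ : ℂ) - 2 + 1 = κ - 1 by ring]
    simp only [D, div_eq_mul_inv]
    ring
  have hFi : Integrable (𝓕 φ) := by
    rw [funext hFφ]
    exact ((integrable_lineKernel hκ hα hα').comp_neg).const_mul D
  have hinv := congrFun (hφc.fourierInv_fourier_eq hφi hFi) (n : ℝ)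
  rw [Real.fourierInv_eq'] at hinv
  have hL : ∫ v : ℝ, Complex.exp (((2 * π * inner ℝ v (n : ℝ) : ℝ) : ℂ) * Complex.I) • 𝓕 φ v =
      D * ∫ x : ℝ, Complex.exp (-2 * π * Complex.I * n * x) * lineKernel κ y α x := by
    rw [← integral_const_mul, ← integral_neg_eq_self]
    refine integral_congr_ae (ae_of_all _ fun x ↦ ?_)
    simp only [hFφ, neg_neg, smul_eq_mul]
    rw [mul_left_comm]
    congr 3
    simp
    ring
  have hR : φ n = Complex.exp (-(2 * π * n * α)) *
      ∫ s in Ioi (n : ℝ), ((s ^ (κ - 2) : ℝ) : ℂ) * Complex.exp (-(4 * π * y * s)) := by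
    rw [← integral_const_mul, ← integral_Ici_eq_integral_Ioi,
      ← integral_indicator measurableSet_Ici]
    refine integral_congr_ae (ae_of_all _ fun s ↦ ?_)
    have hn : (0 : ℝ) < n := by exact_mod_cast n.pos
    by_cases hs : (n : ℝ) ≤ s
    · have h1 : (n : ℝ) - s ∈ Iic (0 : ℝ) := by simpa using hs
      rw [indicator_of_mem (show s ∈ Ici (n : ℝ) from hs)]
      simp only [ContinuousLinearMap.mul_apply', A, B, expKernel, indicator_of_mem h1]
      have he : Complex.exp (-(r * s)) * Complex.exp (-2 * π * α * ((n - s : ℝ) : ℂ)) =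
          Complex.exp (-(2 * π * n * α)) * Complex.exp (-(4 * π * y * s)) := by
        rw [← Complex.exp_add, ← Complex.exp_add]
        congr 1
        simp only [r]; push_cast; ring
      rw [gammaKernel_of_pos _ _ (hn.trans_le hs), mul_assoc, he]
      ring
    · have h1 : (n : ℝ) - s ∉ Iic (0 : ℝ) := by simpa using hs
      rw [indicator_of_notMem (show s ∉ Ici (n : ℝ) from hs)]
      simp [B, expKernel, indicator_of_notMem h1]
  rw [hL, hR] at hinv
  have hΓ : Complex.Gamma ((κ : ℂ) - 1) ≠ 0 :=
    Complex.Gamma_ne_zero_of_re_pos (by simp; linarith)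
  have hI : (-2 * π * Complex.I : ℂ) ≠ 0 := by simp [hπ.ne']
  have hI2 : (-2 * π * Complex.I : ℂ) ^ ((κ : ℂ) - 1) ≠ 0 := by
    rw [Complex.cpow_ne_zero_iff]; exact Or.inl hI
  have hD : D = Complex.Gamma ((κ : ℂ) - 1) /
      (2 * π * Complex.I * (-2 * π * Complex.I) ^ ((κ : ℂ) - 1)) := by
    simp only [D, Complex.cpow_neg]
    rw [div_eq_mul_inv, mul_inv]; ring
  rw [hD] at hinv
  have hexp : Complex.exp (2 * π * n * α) * Complex.exp (-(2 * π * n * α)) = 1 := by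
    rw [← Complex.exp_add, add_neg_cancel, Complex.exp_zero]
  have h2 : (2 * π * Complex.I : ℂ) ≠ 0 := by simp [hπ.ne']
  have h3 := mul_ne_zero h2 hI2
  rw [div_mul_eq_mul_div, div_eq_iff h3] at hinv
  rw [div_mul_eq_mul_div, eq_div_iff hΓ]
  linear_combination Complex.exp (2 * π * n * α) * hinv +
    (2 * π * Complex.I * (-2 * π * Complex.I) ^ ((κ : ℂ) - 1)) *
    (∫ s in Ioi (n : ℝ), ((s ^ (κ - 2) : ℝ) : ℂ) * Complex.exp (-(4 * π * y * s))) * hexp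

end

section

open Filter Topology ModularGroup

/-! ### Cosets of `Γ_∞` and automorphy factors -/

lemma wt_eq_ofReal (k : ℤ) : wt k = (((k : ℝ) / 2 : ℝ) : ℂ) := by simp [wt]

lemma admissible_of_mem {k : ℤ} {N : ℕ} (hkN : 4 ∣ k ∨ (Odd k ∧ 4 ∣ N)) {M : SL(2, ℤ)}
    (hM : M ∈ CongruenceSubgroup.Gamma0 N) : 4 ∣ k ∨ (Odd k ∧ 4 ∣ M 1 0) := by
  refine hkN.imp_right fun h ↦ ⟨h.1, ?_⟩
  rw [CongruenceSubgroup.Gamma0_mem, ZMod.intCast_zmod_eq_zero_iff_dvd] at hM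
  exact (Int.natCast_dvd_natCast.mpr h.2).trans hM

lemma CuspCosets.rep_mem {N : ℕ} (q : CuspCosets N) : q.rep ∈ CongruenceSubgroup.Gamma0 N :=
  (Quotient.out q : CongruenceSubgroup.Gamma0 N).2

lemma mul_inv_mem_GammaInf {M M' : SL(2, ℤ)} (h0 : M 1 0 = M' 1 0) (h1 : M 1 1 = M' 1 1) :
    M' * M⁻¹ ∈ GammaInf := by
  have hd := det_entries M
  refine ⟨M' 0 1 * M 0 0 - M' 0 0 * M 0 1, Or.inl ?_⟩
  have hd' := det_entries M'
  rw [← h0, ← h1] at hd'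
  ext i j
  rw [Matrix.SpecialLinearGroup.coe_mul, Matrix.SpecialLinearGroup.coe_inv,
    Matrix.adjugate_fin_two, coe_T_zpow]
  fin_cases i <;> fin_cases j <;> simp [Matrix.mul_apply, Fin.sum_univ_two, ← h0, ← h1] <;> linarith

lemma CuspCosets.rep_row_injective {N : ℕ} :
    Function.Injective fun q : CuspCosets N ↦ (![q.rep 1 0, q.rep 1 1] : Fin 2 → ℤ) := by
  intro q q' h
  have h0 : q.rep 1 0 = q'.rep 1 0 := by simpa using congrFun h 0
  have h1 : q.rep 1 1 = q'.rep 1 1 := by simpa using congrFun h 1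
  rw [← Quotient.out_eq q, ← Quotient.out_eq q']
  apply Quotient.sound
  change QuotientGroup.rightRel _ _ _
  rw [QuotientGroup.rightRel_apply, Subgroup.mem_subgroupOf]
  exact mul_inv_mem_GammaInf h0 h1

/-- Absolute convergence of the Eisenstein series of weight `k / 2 > 2`: a coset of `Γ_∞` determines
the bottom row of its representative, and distinct cosets have distinct bottom rows. -/
lemma summable_norm_autFactor {k : ℤ} (hk : 4 < k) {N : ℕ} (hkN : 4 ∣ k ∨ (Odd k ∧ 4 ∣ N)) (z : ℍ) :
    Summable fun q : CuspCosets N ↦ ‖autFactor k q.rep z‖ := by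
  have hκ : 2 < (k : ℝ) / 2 := by
    have : (4 : ℝ) < k := by exact_mod_cast hk
    linarith
  have h : Summable fun x : Fin 2 → ℤ ↦ ‖(x 0 : ℂ) * z + x 1‖ ^ (-((k : ℝ) / 2)) :=
    Summable.of_nonneg_of_le (fun x ↦ by positivity)
      (EisensteinSeries.summand_bound z (by linarith))
      ((EisensteinSeries.summable_one_div_norm_rpow hκ).mul_left _)
  refine Summable.of_nonneg_of_le (fun q ↦ norm_nonneg _) (fun q ↦ ?_)
    (h.comp_injective CuspCosets.rep_row_injective)
  simpa using norm_autFactor_le (admissible_of_mem hkN q.rep_mem) z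

/-- The element `± T^n` of `Γ_∞`, as an element of `Γ₀(N)`; the sign is `-` for `true`. -/
def cuspElement (N : ℕ) (n : ℤ) (b : Bool) : CongruenceSubgroup.Gamma0 N :=
  ⟨if b then -T ^ n else T ^ n, by
    rw [CongruenceSubgroup.Gamma0_mem]
    split_ifs <;> simp [coe_T_zpow]⟩

lemma cuspElement_mem (N : ℕ) (n : ℤ) (b : Bool) :
    cuspElement N n b ∈ GammaInf.subgroupOf (CongruenceSubgroup.Gamma0 N) := by
  rw [Subgroup.mem_subgroupOf]
  cases b
  · exact ⟨n, Or.inl rfl⟩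
  · exact ⟨n, Or.inr rfl⟩

lemma cuspElement_injective {N : ℕ} {n n' : ℤ} {b b' : Bool}
    (h : cuspElement N n b = cuspElement N n' b') : n = n' ∧ b = b' := by
  have h1 := congrArg (fun M : CongruenceSubgroup.Gamma0 N ↦ (M : SL(2, ℤ)) 0 1) h
  have h2 := congrArg (fun M : CongruenceSubgroup.Gamma0 N ↦ (M : SL(2, ℤ)) 0 0) h
  cases b <;> cases b' <;> simp [cuspElement, coe_T_zpow] at h1 h2 ⊢ <;> exact h1

/-- The decomposition of `Γ₀(N)` as the disjoint union of the cosets `{± T^n} · rep q`. -/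
def gammaEquiv (N : ℕ) : (CuspCosets N × ℤ) × Bool ≃ CongruenceSubgroup.Gamma0 N :=
  Equiv.ofBijective (fun x ↦ cuspElement N x.1.2 x.2 * Quotient.out x.1.1) <| by
    constructor
    · rintro ⟨⟨q, n⟩, b⟩ ⟨⟨q', n'⟩, b'⟩ h
      simp only at h
      have hq : q = q' := by
        rw [← Quotient.out_eq q, ← Quotient.out_eq q']
        apply Quotient.sound
        change QuotientGroup.rightRel _ _ _
        rw [QuotientGroup.rightRel_apply]
        have : Quotient.out q' * (Quotient.out q)⁻¹ =
            (cuspElement N n' b')⁻¹ * cuspElement N n b := by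
          rw [eq_inv_mul_iff_mul_eq, ← mul_assoc, ← h, mul_inv_cancel_right]
        rw [this]
        exact mul_mem (inv_mem (cuspElement_mem _ _ _)) (cuspElement_mem _ _ _)
      subst hq
      obtain ⟨rfl, rfl⟩ := cuspElement_injective (mul_right_cancel h)
      rfl
    · intro M
      have h : QuotientGroup.rightRel (GammaInf.subgroupOf (CongruenceSubgroup.Gamma0 N))
          (Quotient.out (Quotient.mk'' M : CuspCosets N)) M :=
        Quotient.exact (Quotient.out_eq (Quotient.mk'' M : CuspCosets N))
      rw [QuotientGroup.rightRel_apply, Subgroup.mem_subgroupOf] at h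
      obtain ⟨n, hn | hn⟩ := h
      · refine ⟨⟨⟨Quotient.mk'' M, n⟩, false⟩, ?_⟩
        have : cuspElement N n false = M * (Quotient.out (Quotient.mk'' M : CuspCosets N))⁻¹ :=
          Subtype.ext hn.symm
        simp only [this, inv_mul_cancel_right]
      · refine ⟨⟨⟨Quotient.mk'' M, n⟩, true⟩, ?_⟩
        have : cuspElement N n true = M * (Quotient.out (Quotient.mk'' M : CuspCosets N))⁻¹ :=
          Subtype.ext hn.symm
        simp only [this, inv_mul_cancel_right]

lemma autFactor_T_zpow_mul (k n : ℤ) (M : SL(2, ℤ)) (z : ℍ) :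
    autFactor k (T ^ n * M) z = autFactor k M z := by
  apply autFactor_congr <;>
    rw [T_pow_mul_apply_one]

/-- The automorphy factor only depends on the coset of `Γ_∞`. -/
lemma autFactor_gammaEquiv {k : ℤ} {N : ℕ} (hkN : 4 ∣ k ∨ (Odd k ∧ 4 ∣ N)) (z : ℍ)
    (x : (CuspCosets N × ℤ) × Bool) :
    autFactor k (gammaEquiv N x : SL(2, ℤ)) z = autFactor k x.1.1.rep z := by
  obtain ⟨⟨q, n⟩, b⟩ := x
  cases b
  · exact autFactor_T_zpow_mul k n q.rep z
  · have h : 4 ∣ k ∨ (Odd k ∧ 4 ∣ (T ^ n * q.rep) 1 0) := by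
      rw [T_pow_mul_apply_one]; exact admissible_of_mem hkN q.rep_mem
    have e : (gammaEquiv N ((q, n), true) : SL(2, ℤ)) = -(T ^ n * q.rep) := neg_mul _ _
    rw [e, autFactor_neg h, autFactor_T_zpow_mul]

lemma coe_gammaEquiv_smul {N : ℕ} (z : ℍ) (x : (CuspCosets N × ℤ) × Bool) :
    (((gammaEquiv N x : SL(2, ℤ)) • z : ℍ) : ℂ) = ((x.1.1.rep • z : ℍ) : ℂ) + x.1.2 := by
  obtain ⟨⟨q, n⟩, b⟩ := x
  have h : ((T ^ n * q.rep) • z : ℍ) = T ^ n • q.rep • z := mul_smul _ _ _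
  have h2 : (((T ^ n * q.rep) • z : ℍ) : ℂ) = ((q.rep • z : ℍ) : ℂ) + n := by
    rw [h, coe_T_zpow_smul_eq]
  cases b
  · exact h2
  · rw [← h2]
    change (((-T ^ n * q.rep) • z : ℍ) : ℂ) = _
    rw [neg_mul, SL_neg_smul]

/-! ### The Fourier expansion of the elliptic Poincaré series -/

/-- The summand of the elliptic Poincaré series `Ψ_{κ,0,N}(w, z)` at the inverse matrix. -/
lemma ellipticTerm_inv {k : ℤ} {N : ℕ} (hkN : 4 ∣ k ∨ (Odd k ∧ 4 ∣ N)) (w z : ℍ)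
    (M : CongruenceSubgroup.Gamma0 N) :
    ellipticTerm k 0 w z M⁻¹ = (starRingEnd ℂ) (autFactor k (M : SL(2, ℤ)) z) *
      ((w : ℂ) - (starRingEnd ℂ) (((M : SL(2, ℤ)) • z : ℍ) : ℂ)) ^ (-wt k) := by
  have h := autFactor_symm (admissible_of_mem hkN (M⁻¹).2) w z
  rw [InvMemClass.coe_inv, inv_inv] at h
  rw [← h, ellipticTerm, slash_eq, InvMemClass.coe_inv, Complex.cpow_neg]
  simp

/-- The summand of `Ψ_{κ,0,N}(w, z)`, indexed by the decomposition of `Γ₀(N)` along `Γ_∞`. -/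
lemma ellipticTerm_gammaEquiv {k : ℤ} {N : ℕ} (hkN : 4 ∣ k ∨ (Odd k ∧ 4 ∣ N)) (w z : ℍ)
    (x : (CuspCosets N × ℤ) × Bool) :
    ellipticTerm k 0 w z (gammaEquiv N x)⁻¹ = (starRingEnd ℂ) (autFactor k x.1.1.rep z) *
      ((w : ℂ) - (starRingEnd ℂ) ((x.1.1.rep • z : ℍ) : ℂ) - x.1.2) ^ (-wt k) := by
  rw [ellipticTerm_inv hkN, autFactor_gammaEquiv hkN, coe_gammaEquiv_smul, map_add, map_intCast,
    sub_sub]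

lemma two_lt_half {k : ℤ} (hk : 4 < k) : 2 < (k : ℝ) / 2 := by
  have : (4 : ℝ) < k := by exact_mod_cast hk
  linarith

lemma summable_mul_cpow_sub_int {ι : Type*} {κ v : ℝ} (hκ : 2 < κ) (hv : 0 < v) {a W : ι → ℂ}
    (ha : Summable fun i ↦ ‖a i‖) (hW : ∀ i, v ≤ (W i).im) :
    Summable fun x : ι × ℤ ↦ a x.1 * (W x.1 - x.2) ^ (-(κ : ℂ)) := by
  -- The bound `C` on the inner sums does not depend on `i`.
  obtain ⟨C, hC⟩ := exists_tsum_norm_sub_int_le hκ hv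
  have hC' : ∀ i, _ := fun i ↦ hC (W i) (hW i)
  let g : ι × ℤ → ℝ := fun x ↦ ‖a x.1‖ * ‖W x.1 - x.2‖ ^ (-κ)
  have hg : 0 ≤ g := fun x ↦ mul_nonneg (norm_nonneg _) (Real.rpow_nonneg (norm_nonneg _) _)
  have hgs : ∀ i, ∑' m : ℤ, g (i, m) = ‖a i‖ * ∑' m : ℤ, ‖W i - m‖ ^ (-κ) := fun i ↦ by
    simp only [g]
    rw [tsum_mul_left]
  have hsum : Summable g := by
    refine (summable_prod_of_nonneg hg).mpr ⟨fun i ↦ (hC' i).1.mul_left ‖a i‖, ?_⟩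
    refine Summable.of_nonneg_of_le (fun i ↦ tsum_nonneg fun m ↦ hg (i, m)) (fun i ↦ ?_)
      (ha.mul_right C)
    rw [hgs]
    exact mul_le_mul_of_nonneg_left (hC' i).2 (norm_nonneg (a i))
  refine Summable.of_norm_bounded hsum fun x ↦ ?_
  rw [norm_mul, norm_cpow_neg_ofReal]

lemma im_le_im_sub_conj (w z : ℍ) : w.im ≤ ((w : ℂ) - (starRingEnd ℂ) (z : ℂ)).im := by
  have := z.im_pos
  simp only [Complex.sub_im, Complex.conj_im, coe_im]
  linarith

lemma summable_cuspSum {k : ℤ} (hk : 4 < k) {N : ℕ} (hkN : 4 ∣ k ∨ (Odd k ∧ 4 ∣ N)) (w z : ℍ) :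
    Summable fun x : CuspCosets N × ℤ ↦ (starRingEnd ℂ) (autFactor k x.1.rep z) *
      ((w : ℂ) - (starRingEnd ℂ) ((x.1.rep • z : ℍ) : ℂ) - x.2) ^ (-wt k) := by
  rw [wt_eq_ofReal]
  exact summable_mul_cpow_sub_int (two_lt_half hk) w.im_pos
    (a := fun q : CuspCosets N ↦ (starRingEnd ℂ) (autFactor k q.rep z))
    (W := fun q : CuspCosets N ↦ (w : ℂ) - (starRingEnd ℂ) ((q.rep • z : ℍ) : ℂ))
    (by simpa only [RCLike.norm_conj] using summable_norm_autFactor hk hkN z)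
    fun q ↦ im_le_im_sub_conj w (q.rep • z)

lemma summable_ellipticTerm {k : ℤ} (hk : 4 < k) {N : ℕ} (hkN : 4 ∣ k ∨ (Odd k ∧ 4 ∣ N)) (w z : ℍ) :
    Summable fun M : CongruenceSubgroup.Gamma0 N ↦ ellipticTerm k 0 w z M := by
  rw [← ((gammaEquiv N).trans (Equiv.inv _)).summable_iff]
  have h : ((fun M : CongruenceSubgroup.Gamma0 N ↦ ellipticTerm k 0 w z M) ∘
      ((gammaEquiv N).trans (Equiv.inv _))) = fun x : (CuspCosets N × ℤ) × Bool ↦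
        (starRingEnd ℂ) (autFactor k x.1.1.rep z) *
      ((w : ℂ) - (starRingEnd ℂ) ((x.1.1.rep • z : ℍ) : ℂ) - x.1.2) ^ (-wt k) :=
    funext fun x ↦ ellipticTerm_gammaEquiv hkN w z x
  rw [h]
  refine Summable.of_norm ((summable_prod_of_nonneg fun x ↦ norm_nonneg _).mpr
    ⟨fun _ ↦ Summable.of_finite, ?_⟩)
  simpa using (summable_cuspSum hk hkN w z).norm.mul_left 2

lemma elliptic_eq_tsum_cuspCosets {k : ℤ} (hk : 4 < k) {N : ℕ} (hkN : 4 ∣ k ∨ (Odd k ∧ 4 ∣ N))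
    (w z : ℍ) :
    elliptic k 0 N w z = 2 * ∑' q : CuspCosets N, (starRingEnd ℂ) (autFactor k q.rep z) *
      ∑' m : ℤ, ((w : ℂ) - (starRingEnd ℂ) ((q.rep • z : ℍ) : ℂ) - m) ^ (-wt k) := by
  have hs := (((gammaEquiv N).trans (Equiv.inv _)).summable_iff).mpr
    (summable_ellipticTerm hk hkN w z)
  rw [elliptic, ← ((gammaEquiv N).trans (Equiv.inv _)).tsum_eq]
  refine hs.tsum_prod.trans ?_
  have h : ∀ x : (CuspCosets N × ℤ) × Bool,
      ((fun M : CongruenceSubgroup.Gamma0 N ↦ ellipticTerm k 0 w z M) ∘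
      ((gammaEquiv N).trans (Equiv.inv _))) x =
        (starRingEnd ℂ) (autFactor k x.1.1.rep z) *
      ((w : ℂ) - (starRingEnd ℂ) ((x.1.1.rep • z : ℍ) : ℂ) - x.1.2) ^ (-wt k) :=
    fun x ↦ ellipticTerm_gammaEquiv hkN w z x
  simp only [h, tsum_fintype, Finset.sum_const, Finset.card_univ, Fintype.card_bool,
    nsmul_eq_mul, Nat.cast_ofNat]
  rw [tsum_mul_left, (summable_cuspSum hk hkN w z).tsum_prod]
  simp only [tsum_mul_left]

lemma summable_rpow_mul_exp (p : ℝ) {a : ℝ} (ha : 0 < a) :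
    Summable fun n : ℕ+ ↦ (n : ℝ) ^ p * Real.exp (-a * n) := by
  have h1 := (isBigO_atTop_gammaKernel (p := p) (r := a) (by simpa using ha) (-2)).norm_left
  have h2 := h1.comp_tendsto tendsto_natCast_atTop_atTop
  have h3 := summable_of_isBigO_nat (Real.summable_nat_rpow.mpr (by norm_num : (-2 : ℝ) < -1)) h2
  refine (h3.comp_injective PNat.coe_injective).congr fun n ↦ ?_
  simp [norm_gammaKernel]

lemma norm_exp_two_pi_I_mul (n : ℕ+) (w : ℂ) :
    ‖Complex.exp (2 * π * Complex.I * n * w)‖ = Real.exp (-(2 * π * w.im) * n) := by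
  rw [Complex.norm_exp]
  congr 1
  rw [show (2 * π * Complex.I * n * w : ℂ) = ((2 * π * n : ℝ) : ℂ) * (Complex.I * w) by
    push_cast; ring, Complex.re_ofReal_mul]
  simp; ring

lemma poincareTerm_eq (k : ℤ) {N : ℕ} (n : ℕ+) (z : ℍ) (q : CuspCosets N) :
    poincareTerm k n z q = autFactor k q.rep z *
      Complex.exp (2 * π * Complex.I * n * ((q.rep • z : ℍ) : ℂ)) := by
  rw [poincareTerm, slash_eq]; simp

lemma norm_poincareTerm_le (k : ℤ) {N : ℕ} (n : ℕ+) (z : ℍ) (q : CuspCosets N) :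
    ‖poincareTerm k n z q‖ ≤ ‖autFactor k q.rep z‖ := by
  rw [poincareTerm_eq, norm_mul, norm_exp_two_pi_I_mul]
  refine mul_le_of_le_one_right (norm_nonneg _) (Real.exp_le_one_iff.mpr ?_)
  have : 0 ≤ 2 * π * ((q.rep • z : ℍ) : ℂ).im * n := by
    have := (q.rep • z).im_pos
    have := Real.pi_pos
    rw [coe_im]; positivity
  linarith

lemma summable_poincareTerm {k : ℤ} (hk : 4 < k) {N : ℕ} (hkN : 4 ∣ k ∨ (Odd k ∧ 4 ∣ N)) (z : ℍ)
    (n : ℕ+) : Summable fun q : CuspCosets N ↦ poincareTerm k n z q :=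
  Summable.of_norm_bounded (summable_norm_autFactor hk hkN z) fun q ↦ norm_poincareTerm_le k n z q

/-- The Poincaré series are bounded in their index. -/
lemma norm_poincare_le {k : ℤ} (hk : 4 < k) {N : ℕ} (hkN : 4 ∣ k ∨ (Odd k ∧ 4 ∣ N)) (z : ℍ)
    (n : ℕ+) : ‖poincare k n N z‖ ≤ ∑' q : CuspCosets N, ‖autFactor k q.rep z‖ :=
  tsum_of_norm_bounded (summable_norm_autFactor hk hkN z).hasSum fun q ↦
    norm_poincareTerm_le k n z q

/-- The Fourier expansion of `w ↦ Ψ_{κ,0,N}(w, z)`: its coefficients are, up to elementary factors,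
the complex conjugates of the Poincaré series at `z`. -/
lemma elliptic_eq_tsum_poincare {k : ℤ} (hk : 4 < k) {N : ℕ} (hkN : 4 ∣ k ∨ (Odd k ∧ 4 ∣ N))
    (w z : ℍ) :
    elliptic k 0 N w z = 2 * (Complex.Gamma (wt k) * (-2 * π * Complex.I) ^ (-wt k))⁻¹ *
      ∑' n : ℕ+, (((n : ℝ) ^ ((k : ℝ) / 2 - 1) : ℝ) : ℂ) *
        Complex.exp (2 * π * Complex.I * n * w) * (starRingEnd ℂ) (poincare k n N z) := by
  have hκ := two_lt_half hk
  set κ := (k : ℝ) / 2 with hκdef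
  have hwt : wt k = (κ : ℂ) := wt_eq_ofReal k
  have hne : Complex.Gamma κ * (-2 * π * Complex.I) ^ (-(κ : ℂ)) ≠ 0 := by
    refine mul_ne_zero (Complex.Gamma_ne_zero_of_re_pos (by simp; linarith)) ?_
    rw [Complex.cpow_ne_zero_iff]
    left; simp [Real.pi_ne_zero]
  have hL : ∀ q : CuspCosets N,
      ∑' m : ℤ, ((w : ℂ) - (starRingEnd ℂ) ((q.rep • z : ℍ) : ℂ) - m) ^ (-(κ : ℂ)) =
      (Complex.Gamma κ * (-2 * π * Complex.I) ^ (-(κ : ℂ)))⁻¹ *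
      ∑' n : ℕ+, (((n : ℝ) ^ (κ - 1) : ℝ) : ℂ) * Complex.exp (2 * π * Complex.I * n *
        ((w : ℂ) - (starRingEnd ℂ) ((q.rep • z : ℍ) : ℂ))) := fun q ↦ by
    rw [eq_inv_mul_iff_mul_eq₀ hne]
    exact lipschitz_summation hκ (w.im_pos.trans_le (im_le_im_sub_conj w (q.rep • z)))
  rw [elliptic_eq_tsum_cuspCosets hk hkN, hwt]
  simp only [hL]
  simp only [mul_left_comm _ (Complex.Gamma κ * (-2 * π * Complex.I) ^ (-(κ : ℂ)))⁻¹ _]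
  rw [tsum_mul_left, ← mul_assoc]
  congr 1
  simp only [← tsum_mul_left]
  have hterm : ∀ (q : CuspCosets N) (n : ℕ+),
      (starRingEnd ℂ) (autFactor k q.rep z) * ((((n : ℝ) ^ (κ - 1) : ℝ) : ℂ) *
        Complex.exp (2 * π * Complex.I * n * ((w : ℂ) - (starRingEnd ℂ) ((q.rep • z : ℍ) : ℂ)))) =
      (((n : ℝ) ^ (κ - 1) : ℝ) : ℂ) * Complex.exp (2 * π * Complex.I * n * w) *
        (starRingEnd ℂ) (poincareTerm k n z q) := by
    intro q n
    rw [poincareTerm_eq, map_mul, ← Complex.exp_conj, mul_sub, Complex.exp_sub, div_eq_mul_inv,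
      ← Complex.exp_neg]
    have : (starRingEnd ℂ) (2 * π * Complex.I * n * ((q.rep • z : ℍ) : ℂ)) =
        -(2 * π * Complex.I * n * (starRingEnd ℂ) ((q.rep • z : ℍ) : ℂ)) := by
      simp only [map_mul, map_ofNat, Complex.conj_ofReal, Complex.conj_I, map_natCast]
      ring
    rw [this]; ring
  simp only [hterm]
  have hsum : Summable (Function.uncurry fun (q : CuspCosets N) (n : ℕ+) ↦
      (((n : ℝ) ^ (κ - 1) : ℝ) : ℂ) * Complex.exp (2 * π * Complex.I * n * w) *
        (starRingEnd ℂ) (poincareTerm k n z q)) := by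
    refine Summable.of_norm_bounded ((summable_norm_autFactor hk hkN z).mul_of_nonneg
      (summable_rpow_mul_exp (κ - 1) (a := 2 * π * w.im) (by have := w.im_pos; positivity))
      (fun q ↦ norm_nonneg _) fun n ↦ by positivity) ?_
    rintro ⟨q, n⟩
    simp only [Function.uncurry]
    rw [norm_mul, norm_mul, RCLike.norm_conj, norm_exp_two_pi_I_mul, coe_im, Complex.norm_real,
      Real.norm_of_nonneg (by positivity), mul_comm]
    exact mul_le_mul_of_nonneg_right (norm_poincareTerm_le k n z q) (by positivity)
  rw [← hsum.tsum_comm]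
  refine tsum_congr fun n ↦ ?_
  rw [tsum_mul_left, poincare, Complex.conj_tsum]

end

section

open Filter Topology

/-! ### Termwise integration -/

lemma setIntegral_comp_add_left {E : Type*} [NormedAddCommGroup E] [NormedSpace ℝ E] (f : ℝ → E)
    (a : ℝ) : ∫ t in Ioi (0 : ℝ), f (a + t) = ∫ s in Ioi a, f s := by
  have := (measurePreserving_add_left volume a).setIntegral_preimage_emb
    (measurableEmbedding_addLeft a) f (Ioi a)
  simpa using this

lemma integrableOn_comp_add_left {E : Type*} [NormedAddCommGroup E] {f : ℝ → E} {a : ℝ}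
    (hf : IntegrableOn f (Ioi a)) : IntegrableOn (fun t ↦ f (a + t)) (Ioi 0) := by
  have := ((measurePreserving_add_left volume a).integrableOn_comp_preimage
    (measurableEmbedding_addLeft a)).mpr hf
  simpa [Function.comp_def] using this

/-- Integration of a series dominated by a summable sequence times an integrable function. -/
lemma integrable_and_hasSum_integral {X ι : Type*} [MeasurableSpace X] {μ : Measure X} [Countable ι]
    {F : ι → X → ℂ} {b : ι → ℝ} {h : X → ℝ} (hF : ∀ i, AEStronglyMeasurable (F i) μ)
    (hb : Summable b) (hh : Integrable h μ) (hbd : ∀ i, ∀ᵐ x ∂μ, ‖F i x‖ ≤ b i * h x) :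
    Integrable (fun x ↦ ∑' i, F i x) μ ∧
      HasSum (fun i ↦ ∫ x, F i x ∂μ) (∫ x, ∑' i, F i x ∂μ) := by
  have hFi : ∀ i, Integrable (F i) μ := fun i ↦ (hh.const_mul (b i)).mono' (hF i) (hbd i)
  have hall : ∀ᵐ x ∂μ, ∀ i, ‖F i x‖ ≤ b i * h x := ae_all_iff.mpr hbd
  constructor
  · refine (hh.const_mul (∑' i, b i)).mono' ?_ ?_
    · refine aestronglyMeasurable_of_tendsto_ae (atTop : Filter (Finset ι))
        (f := fun s x ↦ ∑ i ∈ s, F i x) (fun s ↦ ?_) ?_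
      · exact Finset.aestronglyMeasurable_fun_sum s fun i _ ↦ hF i
      · filter_upwards [hall] with x hx
        exact (Summable.of_norm_bounded (hb.mul_right (h x)) hx).hasSum
    · filter_upwards [hall] with x hx
      exact tsum_of_norm_bounded (hb.hasSum.mul_right (h x)) hx
  · refine hasSum_integral_of_summable_integral_norm hFi ?_
    refine Summable.of_nonneg_of_le (fun i ↦ integral_nonneg fun x ↦ norm_nonneg _) (fun i ↦ ?_)
      (hb.mul_right (∫ x, h x ∂μ))
    rw [← integral_const_mul]
    exact integral_mono_ae (hFi i).norm (hh.const_mul (b i)) (hbd i)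

/-- The function `t ↦ (2y + t)^{κ-2} e^{-2πn(2y+t)}`. -/
def shiftedKernel (κ y : ℝ) (n : ℕ+) (t : ℝ) : ℂ :=
  (((2 * y + t) ^ (κ - 2) : ℝ) : ℂ) * Complex.exp (-(2 * π * n * (2 * y + t)))

/-- The integral of `shiftedKernel` is an incomplete Gamma integral, by the substitution
`s = n(2y + t) / 2y`. -/
lemma integral_shiftedKernel (κ : ℝ) {y : ℝ} (hy : 0 < y) (n : ℕ+) :
    (((n : ℝ) ^ (κ - 1) : ℝ) : ℂ) * ∫ t in Ioi (0 : ℝ), shiftedKernel κ y n t =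
      (((2 * y) ^ (κ - 1) : ℝ) : ℂ) *
        ∫ s in Ioi (n : ℝ), ((s ^ (κ - 2) : ℝ) : ℂ) * Complex.exp (-(4 * π * y * s)) := by
  have hn : (0 : ℝ) < n := by exact_mod_cast n.pos
  have h2y : 0 < 2 * y := by positivity
  have hb : 0 < (n : ℝ) / (2 * y) := by positivity
  have h1 := setIntegral_comp_add_left
    (fun u : ℝ ↦ ((u ^ (κ - 2) : ℝ) : ℂ) * Complex.exp (-(2 * π * n * u))) (2 * y)
  have h2 := integral_comp_mul_left_Ioi'
    (fun s : ℝ ↦ ((s ^ (κ - 2) : ℝ) : ℂ) * Complex.exp (-(4 * π * y * s))) (2 * y) hb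
  rw [div_mul_cancel₀ _ h2y.ne'] at h2
  have h3 : ∫ u in Ioi (2 * y), ((((n : ℝ) / (2 * y) * u) ^ (κ - 2) : ℝ) : ℂ) *
      Complex.exp (-(4 * π * y * (((n : ℝ) / (2 * y) * u : ℝ) : ℂ))) =
      ((((n : ℝ) / (2 * y)) ^ (κ - 2) : ℝ) : ℂ) *
      ∫ u in Ioi (2 * y), ((u ^ (κ - 2) : ℝ) : ℂ) * Complex.exp (-(2 * π * n * u)) := by
    rw [← integral_const_mul]
    refine setIntegral_congr_fun measurableSet_Ioi fun u hu ↦ ?_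
    have hu : 0 < u := h2y.trans hu
    rw [Real.mul_rpow hb.le hu.le, Complex.ofReal_mul, mul_assoc]
    congr 4
    have hyc : (y : ℂ) ≠ 0 := by exact_mod_cast hy.ne'
    push_cast
    field_simp
    ring
  have h4 : ∫ t in Ioi (0 : ℝ), shiftedKernel κ y n t =
      ∫ u in Ioi (2 * y), ((u ^ (κ - 2) : ℝ) : ℂ) * Complex.exp (-(2 * π * n * u)) := by
    rw [← h1]
    refine setIntegral_congr_fun measurableSet_Ioi fun u _ ↦ ?_
    simp [shiftedKernel]
  rw [← h2, h3, ← h4, Complex.real_smul, ← mul_assoc, ← mul_assoc, ← Complex.ofReal_mul,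
    ← Complex.ofReal_mul]
  congr 2
  have g : ∀ x : ℝ, 0 < x → x ^ (κ - 1) = x ^ (κ - 2) * x := fun x hx ↦ by
    rw [← Real.rpow_add_one hx.ne']; congr 1; ring
  have hB : 0 < (2 * y) ^ (κ - 2) := by positivity
  rw [Real.div_rpow hn.le h2y.le, g _ hn, g _ h2y]
  generalize (2 * y) ^ (κ - 2) = B at hB ⊢
  generalize (n : ℝ) ^ (κ - 2) = A
  field_simp

lemma integrableOn_shifted {κ y : ℝ} (hκ : 2 < κ) (hy : 0 < y) :
    IntegrableOn (fun t : ℝ ↦ (2 * y + t) ^ (κ - 2) * Real.exp (-(2 * π) * (2 * y + t))) (Ioi 0) :=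
  integrableOn_comp_add_left (f := fun s : ℝ ↦ s ^ (κ - 2) * Real.exp (-(2 * π) * s))
    ((integrableOn_rpow_mul_exp (by linarith) (by positivity)).mono_set
      (Ioi_subset_Ioi (by positivity)))

/-- The gain `e^{-4πy(n-1)}` makes the termwise integrated series converge: it outweighs the growth
`e^{2πny}` of `e^{-2πinτ}`. -/
lemma norm_shiftedKernel_le {κ y : ℝ} (hy : 0 < y) (n : ℕ+) {t : ℝ} (ht : 0 < t) :
    ‖shiftedKernel κ y n t‖ ≤ Real.exp (-(4 * π * y) * (n - 1)) *
      ((2 * y + t) ^ (κ - 2) * Real.exp (-(2 * π) * (2 * y + t))) := by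
  have h0 : 0 < 2 * y + t := by positivity
  have hn : (1 : ℝ) ≤ n := by exact_mod_cast n.pos
  rw [shiftedKernel, norm_mul, Complex.norm_exp, Complex.norm_real,
    Real.norm_of_nonneg (by positivity), mul_left_comm, ← Real.exp_add]
  refine mul_le_mul_of_nonneg_left (Real.exp_le_exp.mpr ?_) (by positivity)
  have e : (-(2 * π * n * (2 * y + t)) : ℂ).re = -(2 * π * n * (2 * y + t)) := by
    rw [← Complex.ofReal_re (-(2 * π * n * (2 * y + t)))]; push_cast; rfl
  rw [e]
  have : 0 ≤ 2 * π * t * (n - 1) := by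
    have := Real.pi_pos
    have : 0 ≤ (n : ℝ) - 1 := by linarith
    positivity
  linarith

/-! ### The Eichler integral -/

/-- The number `n^{κ-1} e^{-2πinτ} 𝒫_{κ,n,N}(z)`; the factor `n^{κ-1} 𝒫_{κ,n,N}(z)` is the conjugate of
the `n`-th Fourier coefficient of `Ψ_{κ,0,N}(·, z)`, up to a constant. -/
def eichlerCoeff (k : ℤ) (N : ℕ) (z τ : ℍ) (n : ℕ+) : ℂ :=
  (((n : ℝ) ^ ((k : ℝ) / 2 - 1) : ℝ) : ℂ) * Complex.exp (-2 * π * Complex.I * n * τ) *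
    poincare k n N z

/-- The constant `2 (2πi)^κ i^{κ-1} / Γ(κ)` by which the integrand of the Eichler integral differs from
the series of `eichlerCoeff` times `shiftedKernel`. -/
def eichlerConst (k : ℤ) : ℂ :=
  2 * (Complex.Gamma (wt k) * (2 * π * Complex.I) ^ (-wt k))⁻¹ * Complex.I ^ (wt k - 1)

lemma ofReal_mul_cpow {a : ℝ} (ha : 0 < a) (x s : ℂ) :
    ((a : ℂ) * x) ^ s = (a : ℂ) ^ s * x ^ s := by
  rcases eq_or_ne x 0 with rfl | hx
  · rcases eq_or_ne s 0 with rfl | hs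
    · simp
    · simp [Complex.zero_cpow hs]
  · have ha' : (a : ℂ) ≠ 0 := by exact_mod_cast ha.ne'
    rw [Complex.cpow_def_of_ne_zero (mul_ne_zero ha' hx), Complex.cpow_def_of_ne_zero ha',
      Complex.cpow_def_of_ne_zero hx, ← Complex.exp_add, Complex.log_ofReal_mul ha hx,
      Complex.ofReal_log ha.le, add_mul]

lemma conj_wt (k : ℤ) : (starRingEnd ℂ) (wt k) = wt k := by
  rw [wt_eq_ofReal, Complex.conj_ofReal]

/-- The Fourier expansion of the integrand: with `w = -conj τ + it` one has `w + τ = i(2y + t)` and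
`e^{2πinw} = e^{-2πinτ} e^{-2πn(2y + t)}`. -/
lemma eichlerIntegrand_eq {k : ℤ} (hk : 4 < k) {N : ℕ} (hkN : 4 ∣ k ∨ (Odd k ∧ 4 ∣ N))
    (z τ : ℍ) {t : ℝ} (ht : 0 < t) :
    eichlerIntegrand k (fun w ↦ elliptic k 0 N w z) τ t =
      ∑' n : ℕ+, eichlerConst k * eichlerCoeff k N z τ n *
        shiftedKernel ((k : ℝ) / 2) τ.im n t := by
  have h2 : 0 < 2 * τ.im + t := by have := τ.im_pos; positivity
  have him : 0 < ((negConj τ : ℂ) + t * Complex.I).im := by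
    have h := (negConj τ).im_pos
    rw [Complex.add_im, coe_im]
    simp; positivity
  have hW : (negConj τ : ℂ) + t * Complex.I + τ = ((2 * τ.im + t : ℝ) : ℂ) * Complex.I := by
    change -(starRingEnd ℂ) (τ : ℂ) + t * Complex.I + τ = _
    apply Complex.ext <;> simp; ring
  rw [eichlerIntegrand, conjFun, ofComplex_apply_of_im_pos him, hW,
    elliptic_eq_tsum_poincare hk hkN, map_mul, Complex.conj_tsum, ofReal_mul_cpow h2, ← tsum_mul_left,
    ← tsum_mul_right, ← tsum_mul_right]
  refine tsum_congr fun n ↦ ?_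
  have hI : Complex.I ^ (wt k - 1) = Complex.I ^ (wt k - 2) * Complex.I := by
    rw [show wt k - 1 = wt k - 2 + 1 by ring, Complex.cpow_add _ _ Complex.I_ne_zero,
      Complex.cpow_one]
  have hconst : (starRingEnd ℂ) (2 * (Complex.Gamma (wt k) * (-2 * π * Complex.I) ^ (-wt k))⁻¹) =
      2 * (Complex.Gamma (wt k) * (2 * π * Complex.I) ^ (-wt k))⁻¹ := by
    have hne : (-2 * π * Complex.I : ℂ).im ≠ 0 := by simp [Real.pi_ne_zero]
    rw [map_mul, map_inv₀, map_mul, ← Complex.Gamma_conj, conj_wt,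
      cpow_conj_of_im_ne_zero hne (by rw [map_neg, conj_wt]), map_ofNat]
    congr 5
    simp only [map_mul, map_neg, map_ofNat, Complex.conj_ofReal, Complex.conj_I]
    ring
  have hexp : (starRingEnd ℂ) (Complex.exp (2 * π * Complex.I * n *
      ((negConj ⟨(negConj τ : ℂ) + t * Complex.I, him⟩ : ℍ) : ℂ))) =
      Complex.exp (-2 * π * Complex.I * n * τ) *
        Complex.exp (-(2 * π * n * (2 * τ.im + t))) := by
    rw [← Complex.exp_conj, ← Complex.exp_add]
    congr 1
    change (starRingEnd ℂ) (2 * π * Complex.I * n *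
      (-(starRingEnd ℂ) ((negConj τ : ℂ) + t * Complex.I))) = _
    rw [eq_sub_of_add_eq hW]
    simp only [map_mul, map_neg, map_ofNat, Complex.conj_ofReal, Complex.conj_I, map_natCast,
      Complex.conj_conj, map_sub]
    push_cast
    linear_combination (2 * π * n * (2 * τ.im + t)) * Complex.I_mul_I
  have hwt2 : (((2 * τ.im + t : ℝ) : ℂ)) ^ (wt k - 2) =
      (((2 * τ.im + t) ^ ((k : ℝ) / 2 - 2) : ℝ) : ℂ) := by
    rw [Complex.ofReal_cpow h2.le, wt_eq_ofReal]; push_cast; rfl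
  rw [hconst, map_mul, map_mul, hexp, Complex.conj_ofReal, Complex.conj_conj, hwt2, eichlerConst,
    eichlerCoeff, shiftedKernel, hI]
  ring

lemma norm_eichlerCoeff (k : ℤ) (N : ℕ) (z τ : ℍ) (n : ℕ+) :
    ‖eichlerCoeff k N z τ n‖ =
      (n : ℝ) ^ ((k : ℝ) / 2 - 1) * Real.exp (2 * π * τ.im * n) * ‖poincare k n N z‖ := by
  have := norm_exp_two_pi_I_mul n (-(τ : ℂ))
  rw [show (2 * π * Complex.I * n * -(τ : ℂ)) = -2 * π * Complex.I * n * τ by ring] at this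
  rw [eichlerCoeff, norm_mul, norm_mul, this, Complex.norm_real,
    Real.norm_of_nonneg (by positivity)]
  simp

/-- Termwise integration of the Eichler integral of the elliptic Poincaré series. -/
lemma integrable_and_hasSum_eichler {k : ℤ} (hk : 4 < k) {N : ℕ} (hkN : 4 ∣ k ∨ (Odd k ∧ 4 ∣ N))
    (z τ : ℍ) :
    IntegrableOn (eichlerIntegrand k (fun w ↦ elliptic k 0 N w z) τ) (Ioi 0) ∧
    HasSum (fun n : ℕ+ ↦ eichlerConst k * (((2 * τ.im) ^ ((k : ℝ) / 2 - 1) : ℝ) : ℂ) *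
      ((∫ s in Ioi (n : ℝ), ((s ^ ((k : ℝ) / 2 - 2) : ℝ) : ℂ) *
        Complex.exp (-(4 * π * τ.im * s))) *
          Complex.exp (-2 * π * Complex.I * n * τ) * poincare k n N z))
      (∫ t in Ioi (0 : ℝ), eichlerIntegrand k (fun w ↦ elliptic k 0 N w z) τ t) := by
  have hκ := two_lt_half hk
  have hy := τ.im_pos
  set S := ∑' q : CuspCosets N, ‖autFactor k q.rep z‖
  have hcongr : EqOn (eichlerIntegrand k (fun w ↦ elliptic k 0 N w z) τ)
      (fun t ↦ ∑' n : ℕ+, eichlerConst k * eichlerCoeff k N z τ n *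
        shiftedKernel ((k : ℝ) / 2) τ.im n t) (Ioi 0) :=
    fun t ht ↦ eichlerIntegrand_eq hk hkN z τ ht
  have hmeas : ∀ n : ℕ+, AEStronglyMeasurable (fun t ↦ eichlerConst k * eichlerCoeff k N z τ n *
      shiftedKernel ((k : ℝ) / 2) τ.im n t) (volume.restrict (Ioi 0)) := fun n ↦ by
    refine Measurable.aestronglyMeasurable ?_
    unfold shiftedKernel
    fun_prop
  have hsum : Summable fun n : ℕ+ ↦ ‖eichlerConst k‖ * S * Real.exp (4 * π * τ.im) *
      ((n : ℝ) ^ ((k : ℝ) / 2 - 1) * Real.exp (-(2 * π * τ.im) * n)) :=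
    (summable_rpow_mul_exp _ (by positivity)).mul_left _
  obtain ⟨h1, h2⟩ := integrable_and_hasSum_integral hmeas hsum (integrableOn_shifted hκ hy)
    fun n ↦ (ae_restrict_iff' measurableSet_Ioi).mpr (ae_of_all _ fun t ht ↦ by
      have hS := norm_poincare_le hk hkN z n
      have e : Real.exp (4 * π * τ.im) * Real.exp (-(2 * π * τ.im) * n) =
          Real.exp (2 * π * τ.im * n) * Real.exp (-(4 * π * τ.im) * (n - 1)) := by
        rw [← Real.exp_add, ← Real.exp_add]; congr 1; ring
      have hk' := norm_shiftedKernel_le (κ := (k : ℝ) / 2) hy n ht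
      rw [norm_mul, norm_mul, norm_eichlerCoeff]
      calc _ ≤ ‖eichlerConst k‖ * ((n : ℝ) ^ ((k : ℝ) / 2 - 1) * Real.exp (2 * π * τ.im * n) * S) *
            (Real.exp (-(4 * π * τ.im) * (n - 1)) * ((2 * τ.im + t) ^ ((k : ℝ) / 2 - 2) *
              Real.exp (-(2 * π) * (2 * τ.im + t)))) := by gcongr
        _ = _ := by
          linear_combination (-‖eichlerConst k‖ * S * (n : ℝ) ^ ((k : ℝ) / 2 - 1) *
            ((2 * τ.im + t) ^ ((k : ℝ) / 2 - 2) * Real.exp (-(2 * π) * (2 * τ.im + t)))) * e)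
  refine ⟨(integrableOn_congr_fun hcongr measurableSet_Ioi).mpr h1, ?_⟩
  rw [setIntegral_congr_fun measurableSet_Ioi hcongr]
  convert h2 using 2 with n
  rw [integral_const_mul, eichlerCoeff]
  linear_combination (-eichlerConst k * Complex.exp (-2 * π * Complex.I * n * τ) * poincare k n N z) *
    integral_shiftedKernel ((k : ℝ) / 2) hy n

lemma eichlerConst_ne_zero {k : ℤ} (hk : 4 < k) : eichlerConst k ≠ 0 := by
  have hκ := two_lt_half hk
  rw [eichlerConst, wt_eq_ofReal]
  refine mul_ne_zero (mul_ne_zero two_ne_zero (inv_ne_zero (mul_ne_zero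
    (Complex.Gamma_ne_zero_of_re_pos (by rw [Complex.ofReal_re]; linarith)) ?_))) ?_ <;>
  · rw [Complex.cpow_ne_zero_iff]
    left; simp [Real.pi_ne_zero]

/-- Comparison of the constants on the two sides. -/
lemma constant_identity {k : ℤ} (hk : 4 < k) {y : ℝ} (hy : 0 < y) :
    Complex.I / π * (2 * Complex.I * y) ^ (wt k - 1) *
      (2 * π * Complex.I * (-2 * π * Complex.I) ^ (wt k - 1) / Complex.Gamma (wt k - 1)) =
    -((2 : ℂ) ^ (wt k - 2) * (wt k - 1) / (Complex.I ^ wt k * π)) *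
      ((2 * Complex.I) ^ (1 - wt k) *
        (eichlerConst k * (((2 * y) ^ ((k : ℝ) / 2 - 1) : ℝ) : ℂ))) := by
  have hκ := two_lt_half hk
  have hπ : (π : ℂ) ≠ 0 := by exact_mod_cast Real.pi_ne_zero
  have hπ2 : 0 < 2 * π := by have := Real.pi_pos; positivity
  have hre : 0 < (wt k - 1).re := by
    rw [wt_eq_ofReal, Complex.sub_re, Complex.ofReal_re, Complex.one_re]; linarith
  have hw1 : wt k - 1 ≠ 0 := fun h ↦ by rw [h] at hre; simp at hre
  have hΓ1 := Complex.Gamma_ne_zero_of_re_pos hre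
  have hΓ : Complex.Gamma (wt k) = (wt k - 1) * Complex.Gamma (wt k - 1) := by
    rw [← Complex.Gamma_add_one _ hw1, sub_add_cancel]
  set s := wt k with hs
  have e1 : (2 * Complex.I * y : ℂ) ^ (s - 1) = ((2 * y : ℝ) : ℂ) ^ (s - 1) * Complex.I ^ (s - 1) := by
    rw [← ofReal_mul_cpow (by positivity)]; congr 1; push_cast; ring
  have e2 : (-2 * π * Complex.I : ℂ) ^ (s - 1) =
      ((2 * π : ℝ) : ℂ) ^ (s - 1) * (Complex.I ^ (s - 1))⁻¹ := by
    rw [← Complex.inv_cpow _ _ (by rw [Complex.arg_I]; have := Real.pi_pos; linarith),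
      ← ofReal_mul_cpow hπ2, Complex.inv_I]
    congr 1; push_cast; ring
  have e3 : (2 * Complex.I : ℂ) ^ (1 - s) = (2 : ℂ) ^ (1 - s) * Complex.I ^ (1 - s) := by
    simpa using ofReal_mul_cpow two_pos Complex.I (1 - s)
  have e4 : (2 * π * Complex.I : ℂ) ^ (-s) = ((2 * π : ℝ) : ℂ) ^ (-s) * Complex.I ^ (-s) := by
    rw [← ofReal_mul_cpow hπ2]; push_cast; rfl
  have e5 : (((2 * y) ^ ((k : ℝ) / 2 - 1) : ℝ) : ℂ) = ((2 * y : ℝ) : ℂ) ^ (s - 1) := by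
    rw [Complex.ofReal_cpow (by positivity), hs, wt_eq_ofReal]; push_cast; rfl
  have hI0 := Complex.I_ne_zero
  have h2π : ((2 * π : ℝ) : ℂ) ≠ 0 := by exact_mod_cast hπ2.ne'
  have hIs : Complex.I ^ s ≠ 0 := by rw [Complex.cpow_ne_zero_iff]; exact Or.inl hI0
  have h2s : (2 : ℂ) ^ s ≠ 0 := by rw [Complex.cpow_ne_zero_iff]; exact Or.inl two_ne_zero
  have hPs : ((2 * π : ℝ) : ℂ) ^ s ≠ 0 := by rw [Complex.cpow_ne_zero_iff]; exact Or.inl h2π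
  have f1 : Complex.I ^ (1 - s) = Complex.I / Complex.I ^ s := by
    rw [Complex.cpow_sub _ _ hI0, Complex.cpow_one]
  have f2 : Complex.I ^ (s - 1) = Complex.I ^ s / Complex.I := by
    rw [Complex.cpow_sub _ _ hI0, Complex.cpow_one]
  have f3 : ((2 * π : ℝ) : ℂ) ^ (s - 1) = ((2 * π : ℝ) : ℂ) ^ s / (2 * π) := by
    rw [Complex.cpow_sub _ _ h2π, Complex.cpow_one]; push_cast; rfl
  have f4 : (2 : ℂ) ^ (s - 2) = (2 : ℂ) ^ s / 4 := by
    rw [Complex.cpow_sub _ _ two_ne_zero, Complex.cpow_ofNat]; norm_num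
  have f5 : (2 : ℂ) ^ (1 - s) = 2 / (2 : ℂ) ^ s := by
    rw [Complex.cpow_sub _ _ two_ne_zero, Complex.cpow_one]
  rw [eichlerConst, ← hs, e1, e2, e3, e4, e5, hΓ, f1, f2, f3, f4, f5, Complex.cpow_neg,
    Complex.cpow_neg]
  field_simp
  simp only [Complex.I_sq]
  ring

/-- The summands of `K` are multiples of those in `integrable_and_hasSum_eichler`. -/
lemma KTerm_eq {k : ℤ} (hk : 4 < k) (N : ℕ) {α : ℝ} (z τ : ℍ) (hα : -2 * τ.im < α) (hα' : α < 0)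
    (n : ℕ+) :
    KTerm k N α z τ n =
      2 * π * Complex.I * (-2 * π * Complex.I) ^ (wt k - 1) / Complex.Gamma (wt k - 1) *
      ((∫ s in Ioi (n : ℝ), ((s ^ ((k : ℝ) / 2 - 2) : ℝ) : ℂ) *
        Complex.exp (-(4 * π * τ.im * s))) *
          Complex.exp (-2 * π * Complex.I * n * τ) * poincare k n N z) := by
  have h := integral_exp_mul_lineKernel (two_lt_half hk) hα hα' n
  rw [KTerm, lineIntegral, funext (lineIntegrand_eq k n τ.im α), integral_const_mul, h,
    wt_eq_ofReal]
  ring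

end

end Petersson

end

/-- Petersson's function `K_{κ,N}(z, τ)`, `κ = k / 2 > 2`, is an explicit multiple of the
non-holomorphic Eichler integral at `τ` of `w ↦ Ψ_{κ,0,N}(w, z)`.  All the series converge
absolutely and all the integrals exist. -/
theorem theorem4p2 (k : ℤ) (N : ℕ) (hk : 4 < k) (hN : 0 < N)
    (hkN : 4 ∣ k ∨ (Odd k ∧ 4 ∣ N)) (z τ : UpperHalfPlane) (α : ℝ)
    (hα : -2 * τ.im < α) (hα' : α < 0) :
    (∀ w : UpperHalfPlane, Summable fun M : CongruenceSubgroup.Gamma0 N =>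
      Petersson.ellipticTerm k 0 w z M) ∧
    (∀ n : ℕ+, Summable fun q : Petersson.CuspCosets N => Petersson.poincareTerm k n z q) ∧
    (∀ n : ℕ+, MeasureTheory.Integrable (Petersson.lineIntegrand k (-(n : ℤ)) τ.im α)) ∧
    (Summable fun n : ℕ+ => Petersson.KTerm k N α z τ n) ∧
    MeasureTheory.IntegrableOn
      (Petersson.eichlerIntegrand k (fun w => Petersson.elliptic k 0 N w z) τ)
      (Set.Ioi (0 : ℝ)) ∧
    Petersson.K k N α z τ =
      -((2 : ℂ) ^ (Petersson.wt k - 2) * (Petersson.wt k - 1) /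
          (Complex.I ^ Petersson.wt k * Real.pi)) *
        Petersson.eichler k (fun w => Petersson.elliptic k 0 N w z) τ := by
  open Petersson in
  obtain ⟨hint, hsum⟩ := integrable_and_hasSum_eichler hk hkN z τ
  have hc : eichlerConst k * (((2 * τ.im) ^ ((k : ℝ) / 2 - 1) : ℝ) : ℂ) ≠ 0 := by
    refine mul_ne_zero (eichlerConst_ne_zero hk) ?_
    have := τ.im_pos
    exact_mod_cast (show (2 * τ.im) ^ ((k : ℝ) / 2 - 1) ≠ 0 by positivity)
  have hS := (summable_mul_left_iff hc).mp hsum.summable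
  refine ⟨fun w ↦ summable_ellipticTerm hk hkN w z, summable_poincareTerm hk hkN z,
    integrable_lineIntegrand hk hα hα', ?_, hint, ?_⟩
  · rw [funext (KTerm_eq hk N z τ hα hα')]
    exact hS.mul_left _
  · rw [K, eichler, ← hsum.tsum_eq, tsum_mul_left, funext (KTerm_eq hk N z τ hα hα'),
      tsum_mul_left, ← mul_assoc, constant_identity hk τ.im_pos]
    ring
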